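/- For integers $0\le b\le t\le m$ let $J(m,t,b)$ be the graph whose vertices are the $t$-element subsets of $[m]$, two distinct vertices $S,T$ being adjacent iff $|S\cap T|=b$. For a finite simple graph $G=(V,E)$ and $z\in\{0,1\}^V$ let $C(z)=\frac12\sum_{ij\in E}(1-x_ix_j)$ with $x_i=(-1)^{z_i}$, and let $\text{Max-Cut}(G)=\max_z C(z)$. On $(\mathbb{C}^2)^{\otimes V}$ let $C$ be the diagonal operator $C|z\rangle=C(z)|z\rangle$, let $B=\sum_{v\in V}X_v$ with $X_v$ the Pauli $X$ operator on qubit $v$, and let $|+\rangle=2^{-|V|/2}\sum_z|z\rangle$. The expected cut value of depth-$1$ QAOA at optimal parameters is $$F_1(G)=\max_{\gamma,\beta\in\mathbb{R}}\langle\psi_{\gamma,\beta}|C|\psi_{\gamma,\beta}\rangle,\qquad |\psi_{\gamma,\beta}\rangle=e^{-i\beta B}e^{-i\gamma C}|+\rangle .$$ **Theorem.** The function $\theta\mapsto\frac{2}{\pi}\frac{\theta}{1-\cos\theta}$ has a unique minimizer $\theta^*$ on $(0,\pi]$. For even $m$ let $G_m=J(m,m/2,b)$ with $b=\left\lceil\frac14(\cos\theta^*+1)m\right\rceil$.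 Then for all even $m\ge 12$ the maximum defining $F_1(G_m)$ is attained, and $$\lim_{\substack{m\to\infty\\ m\text{ even}}}\frac{F_1(G_m)}{\text{Max-Cut}(G_m)}=\frac{1}{1-\cos\theta^*}\approx 0.592,$$ where the approximation means $\left|\frac{1}{1-\cos\theta^*}-0.592\right|<0.0005$. -/

import Mathlib

open scoped Matrix

noncomputable section

/-- The graph `J(m, t, b)`: its vertices are the `t`-element subsets of an `m`-element set, and two
distinct vertices are adjacent iff they have exactly `b` elements in common. -/
def karloffJ (m t b : ℕ) : SimpleGraph {S : Finset (Fin m) // S.card = t} where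
  Adj S T := S ≠ T ∧ (S.1 ∩ T.1).card = b
  symm := ⟨fun _ _ h => ⟨h.1.symm, by rw [Finset.inter_comm]; exact h.2⟩⟩
  loopless := ⟨fun _ h => h.1 rfl⟩

instance karloffJDecidableRel (m t b : ℕ) : DecidableRel (karloffJ m t b).Adj :=
  fun S T => inferInstanceAs (Decidable (S ≠ T ∧ (S.1 ∩ T.1).card = b))

/-- `θ` minimizes `(2 / π) * θ / (1 - cos θ)` over `[0, π]`. The point `0`, where the quotient is
undefined (it tends to `+∞` there), is left out. -/
def IsGWAngle (θ : ℝ) : Prop :=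
  θ ∈ Set.Ioc 0 Real.pi ∧
    IsMinOn (fun x : ℝ => 2 / Real.pi * (x / (1 - Real.cos x))) (Set.Ioc 0 Real.pi) θ

/-- The parameter `b = ⌈(cos θ + 1) m / 4⌉`. -/
def karloffB (θ : ℝ) (m : ℕ) : ℕ := ⌈(1 / 4 : ℝ) * (Real.cos θ + 1) * m⌉₊

/-- The graph `G_m = J(m, m / 2, b)` with `b = ⌈(cos θ + 1) m / 4⌉` (used for even `m`). -/
abbrev karloffG (θ : ℝ) (m : ℕ) : SimpleGraph {S : Finset (Fin m) // S.card = m / 2} :=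
  karloffJ m (m / 2) (karloffB θ m)

section MaxCut

variable {V : Type*} [Fintype V] [DecidableEq V]

/-- The two values of a bit as a spin `±1`. -/
def spin (a : Bool) : ℝ := if a then -1 else 1

/-- The value `(1 / 2) ∑_{ij ∈ E} (1 - x_i x_j)` of the cut given by the bit string `z`, where
`x_i = spin (z i)`. -/
def cutValue (G : SimpleGraph V) [DecidableRel G.Adj] (z : V → Bool) : ℝ :=
  1 / 2 * ∑ e ∈ G.edgeFinset,
    Sym2.lift ⟨fun i j => 1 - spin (z i) * spin (z j), fun i j => by simp only [mul_comm]⟩ e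

/-- The maximum of the cut value over all bit strings. -/
def maxCut (G : SimpleGraph V) [DecidableRel G.Adj] : ℝ :=
  (Finset.univ : Finset (V → Bool)).sup' Finset.univ_nonempty (cutValue G)

/-- The cost Hamiltonian `C`, with `C |z⟩ = cutValue z • |z⟩`, on the space of one qubit per vertex
with its computational basis indexed by bit strings. -/
def costHamiltonian (G : SimpleGraph V) [DecidableRel G.Adj] :
    Matrix (V → Bool) (V → Bool) ℂ :=
  Matrix.diagonal fun z => (cutValue G z : ℂ)

variable (V) in
/-- The Pauli operator `X` on the qubit `v`, which flips the bit `v`. -/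
def pauliX (v : V) : Matrix (V → Bool) (V → Bool) ℂ :=
  Matrix.of fun x y => if x = Function.update y v (!(y v)) then 1 else 0

variable (V) in
/-- The mixing Hamiltonian `B = ∑ v, X_v`. -/
def mixerHamiltonian : Matrix (V → Bool) (V → Bool) ℂ := ∑ v, pauliX V v

variable (V) in
/-- The uniform superposition of all bit strings. -/
def plusState : (V → Bool) → ℂ := fun _ => ((1 / Real.sqrt (2 ^ Fintype.card V) : ℝ) : ℂ)

/-- The depth-`p` QAOA state
`exp (-i β_p B) exp (-i γ_p C) ⋯ exp (-i β_1 B) exp (-i γ_1 C) |+⟩`. -/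
def qaoaState (G : SimpleGraph V) [DecidableRel G.Adj] :
    (p : ℕ) → (Fin p → ℝ) → (Fin p → ℝ) → ((V → Bool) → ℂ)
  | 0, _, _ => plusState V
  | p + 1, γ, β =>
      NormedSpace.exp ((-Complex.I * (β (Fin.last p) : ℂ)) • mixerHamiltonian V) *ᵥ
        (NormedSpace.exp ((-Complex.I * (γ (Fin.last p) : ℂ)) • costHamiltonian G) *ᵥ
          qaoaState G p (fun k => γ k.castSucc) (fun k => β k.castSucc))

/-- The expected cut value `⟨ψ| C |ψ⟩` in the depth-`p` QAOA state with parameters `γ`, `β`. -/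
def qaoaExpectation (G : SimpleGraph V) [DecidableRel G.Adj] (p : ℕ) (γ β : Fin p → ℝ) : ℝ :=
  (star (qaoaState G p γ β) ⬝ᵥ (costHamiltonian G *ᵥ qaoaState G p γ β)).re

/-- The expected cut value of depth-`p` QAOA at optimal parameters. -/
def qaoaValue (G : SimpleGraph V) [DecidableRel G.Adj] (p : ℕ) : ℝ :=
  ⨆ q : (Fin p → ℝ) × (Fin p → ℝ), qaoaExpectation G p q.1 q.2

end MaxCut

end

/-! Write t = m/2 and p = b/t. The graph is regular of degree d = C(t,b)². The ratio follows from
comparing both F₁ and Max-Cut with the number |E| of edges: F₁ is asymptotically |E|/2, and Max-Cut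
is exactly |E|(1 - p) once p is near 0.155. So the ratio tends to the limit of 1/(2(1 - p)), and p
tends to (cos θ* + 1)/2 by the choice of b.

QAOA side. In the Heisenberg picture the correlation of an edge is an explicit trigonometric
expression, `edgeCorrelation`. Its sin²(2β) term is nonnegative on a regular graph, and the rest is
at most 1/√(d-1) in absolute value, so no choice of angles beats a random cut by more than the
factor 1 + 1/√(d-1) (`qaoaValue_one_le`); zero angles give the random cut itself
(`le_qaoaValue_one`). Since d ≥ m, the gain disappears in the limit. The maximum is attained because
the expectation is continuous and periodic in both angles.

Max-Cut side. Cutting by membership of one fixed element gives the lower bound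
(`le_maxCut_karloffJ`). The matching upper bound is spectral: if all adjacency eigenvalues are at
least -R, every cut is at most |V|(d + R)/4. For `neg_le_eigenvalue`, antisymmetrise an eigenvector
under a transposition. If the eigenvector was invariant under all transpositions, it is constant and
its eigenvalue is nonnegative. If the antisymmetrised vector is invariant under transpositions of
the other elements, it is determined up to scale and its eigenvalue is -d(1 - 2p). Otherwise
antisymmetrise under a second, disjoint transposition; the result lives on sets splitting both
pairs, and the eigenvalue is at most the number of neighbours that do so, which is below d(1 - 2p)
for p in [0.154, 0.158]. With R = d(1 - 2p) the two bounds coincide (`maxCut_karloffJ`).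

Angle. The minimiser is the unique positive zero of `gwDeriv` up to π, where tan(θ/2) = θ, so a
numerical enclosure of θ* bounds cos θ* and the limit by rational functions. -/

/-! ### The Goemans–Williamson angle. -/

/-- Up to a positive factor, the derivative of `x / (1 - cos x)`. -/
noncomputable def gwDeriv (x : ℝ) : ℝ := 1 - Real.cos x - x * Real.sin x

theorem continuous_gwDeriv : Continuous gwDeriv := by
  unfold gwDeriv; fun_prop

theorem hasDerivAt_gwDeriv (x : ℝ) : HasDerivAt gwDeriv (-(x * Real.cos x)) x := by
  have h := ((hasDerivAt_const x (1 : ℝ)).sub (Real.hasDerivAt_cos x)).sub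
    ((hasDerivAt_id x).mul (Real.hasDerivAt_sin x))
  refine h.congr_deriv ?_
  simp

theorem gwDeriv_strictMonoOn : StrictMonoOn gwDeriv (Set.Icc (Real.pi / 2) Real.pi) := by
  apply strictMonoOn_of_deriv_pos (convex_Icc _ _) continuous_gwDeriv.continuousOn
  intro x hx
  rw [interior_Icc] at hx
  rw [(hasDerivAt_gwDeriv x).deriv]
  have := Real.cos_neg_of_pi_div_two_lt_of_lt hx.1 (by linarith [hx.2, Real.pi_pos])
  have : 0 < x := by linarith [hx.1, Real.pi_pos]
  nlinarith

theorem gwDeriv_strictAntiOn : StrictAntiOn gwDeriv (Set.Icc 0 (Real.pi / 2)) := by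
  apply strictAntiOn_of_deriv_neg (convex_Icc _ _) continuous_gwDeriv.continuousOn
  intro x hx
  rw [interior_Icc] at hx
  rw [(hasDerivAt_gwDeriv x).deriv]
  have := Real.cos_pos_of_mem_Ioo ⟨by linarith [hx.1, Real.pi_pos], hx.2⟩
  nlinarith [hx.1, mul_pos hx.1 this]

/-- Multiplying by the conjugate 1 - cos x + x sin x > 0 and using sin² = 1 - cos² removes the sine,
so the sign can be read off from a bound on the cosine alone. -/
theorem gwDeriv_neg_iff {x : ℝ} (hx0 : 0 < x) (hxπ : x < Real.pi) :
    gwDeriv x < 0 ↔ (1 - x ^ 2) < Real.cos x * (1 + x ^ 2) := by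
  have hs := Real.sin_pos_of_pos_of_lt_pi hx0 hxπ
  have hsq := Real.sin_sq_add_cos_sq x
  have hc : 0 < 1 - Real.cos x := by
    rcases (Real.cos_le_one x).lt_or_eq with h | h
    · linarith
    · nlinarith
  have key : gwDeriv x * (1 - Real.cos x + x * Real.sin x)
      = (1 - Real.cos x) * ((1 - x ^ 2) - Real.cos x * (1 + x ^ 2)) := by
    unfold gwDeriv
    linear_combination (-x ^ 2) * hsq
  have hp : 0 < 1 - Real.cos x + x * Real.sin x := by positivity
  constructor
  · intro h
    nlinarith [mul_neg_of_neg_of_pos h hp]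
  · intro h
    by_contra hn
    push Not at hn
    nlinarith [mul_nonneg hn hp.le]

theorem gwDeriv_pos_iff {x : ℝ} (hx0 : 0 < x) (hxπ : x < Real.pi) :
    0 < gwDeriv x ↔ Real.cos x * (1 + x ^ 2) < (1 - x ^ 2) := by
  have hs := Real.sin_pos_of_pos_of_lt_pi hx0 hxπ
  have hsq := Real.sin_sq_add_cos_sq x
  have hc : 0 < 1 - Real.cos x := by
    rcases (Real.cos_le_one x).lt_or_eq with h | h
    · linarith
    · nlinarith
  have key : gwDeriv x * (1 - Real.cos x + x * Real.sin x)
      = (1 - Real.cos x) * ((1 - x ^ 2) - Real.cos x * (1 + x ^ 2)) := by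
    unfold gwDeriv
    linear_combination (-x ^ 2) * hsq
  have hp : 0 < 1 - Real.cos x + x * Real.sin x := by positivity
  constructor
  · intro h
    nlinarith [mul_pos h hp]
  · intro h
    by_contra hn
    push Not at hn
    nlinarith [mul_nonneg (neg_nonneg.2 hn) hp.le]

theorem le_cos_two_mul {x l u : ℝ} (h : l ≤ Real.cos x) (hl : 0 ≤ l) (hu : u ≤ 2 * l ^ 2 - 1) :
    u ≤ Real.cos (2 * x) := by
  rw [Real.cos_two_mul]; nlinarith

theorem cos_two_mul_le {x l u : ℝ} (h : Real.cos x ≤ l) (h0 : 0 ≤ Real.cos x)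
    (hu : 2 * l ^ 2 - 1 ≤ u) : Real.cos (2 * x) ≤ u := by
  rw [Real.cos_two_mul]; nlinarith

/-- At 2.325/64 the quadratic Taylor bound is sharp enough; six applications of the double-angle
formula carry it up to 2.325. -/
theorem neg_lt_cos_left : -0.6874 ≤ Real.cos 2.325 := by
  have h6 : (0.9993401 : ℝ) ≤ Real.cos (2.325 / 64) :=
    le_trans (by norm_num) Real.one_sub_sq_div_two_le_cos
  have h5 : (0.9973612 : ℝ) ≤ Real.cos (2 * (2.325 / 64)) :=
    le_cos_two_mul h6 (by norm_num) (by norm_num)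
  have h4 : (0.9894587 : ℝ) ≤ Real.cos (2 * (2 * (2.325 / 64))) :=
    le_cos_two_mul h5 (by norm_num) (by norm_num)
  have h3 : (0.958057 : ℝ) ≤ Real.cos (2 * (2 * (2 * (2.325 / 64)))) :=
    le_cos_two_mul h4 (by norm_num) (by norm_num)
  have h2 : (0.835746 : ℝ) ≤ Real.cos (2 * (2 * (2 * (2 * (2.325 / 64))))) :=
    le_cos_two_mul h3 (by norm_num) (by norm_num)
  have h1 : (0.39694 : ℝ) ≤ Real.cos (2 * (2 * (2 * (2 * (2 * (2.325 / 64)))))) :=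
    le_cos_two_mul h2 (by norm_num) (by norm_num)
  have h0 : (-0.6874 : ℝ) ≤ Real.cos (2 * (2 * (2 * (2 * (2 * (2 * (2.325 / 64))))))) :=
    le_cos_two_mul h1 (by norm_num) (by norm_num)
  convert h0 using 2; norm_num

theorem cos_right_lt : Real.cos 2.3376 ≤ -0.693 := by
  have hnn : ∀ y : ℝ, 0 ≤ y → y ≤ 1.5 → 0 ≤ Real.cos y := fun y h0 h1 =>
    Real.cos_nonneg_of_mem_Icc ⟨by linarith [Real.pi_gt_three], by linarith [Real.pi_gt_three]⟩
  -- The upper bound starts from the Taylor estimate with fourth-order error term.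
  have h6 : Real.cos (2.3376 / 64) ≤ 0.9993331 := by
    have := (abs_le.1 (Real.cos_bound (x := 2.3376 / 64) (by norm_num [abs_le]))).2
    rw [abs_of_pos (by norm_num)] at this
    norm_num at this ⊢
    linarith
  have h5 : Real.cos (2 * (2.3376 / 64)) ≤ 0.9973333 :=
    cos_two_mul_le h6 (hnn _ (by norm_num) (by norm_num)) (by norm_num)
  have h4 : Real.cos (2 * (2 * (2.3376 / 64))) ≤ 0.9893475 :=
    cos_two_mul_le h5 (hnn _ (by norm_num) (by norm_num)) (by norm_num)
  have h3 : Real.cos (2 * (2 * (2 * (2.3376 / 64)))) ≤ 0.957617 :=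
    cos_two_mul_le h4 (hnn _ (by norm_num) (by norm_num)) (by norm_num)
  have h2 : Real.cos (2 * (2 * (2 * (2 * (2.3376 / 64))))) ≤ 0.834061 :=
    cos_two_mul_le h3 (hnn _ (by norm_num) (by norm_num)) (by norm_num)
  have h1 : Real.cos (2 * (2 * (2 * (2 * (2 * (2.3376 / 64)))))) ≤ 0.39132 :=
    cos_two_mul_le h2 (hnn _ (by norm_num) (by norm_num)) (by norm_num)
  have h0 : Real.cos (2 * (2 * (2 * (2 * (2 * (2 * (2.3376 / 64))))))) ≤ -0.693 :=
    cos_two_mul_le h1 (hnn _ (by norm_num) (by norm_num)) (by norm_num)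
  convert h0 using 2; norm_num

/-- `gwDeriv` vanishes at 0, decreases up to π/2 and then increases, so it has exactly one sign
change on (0, π]. -/
theorem exists_gwDeriv_zero : ∃ θ : ℝ, 2.325 < θ ∧ θ < 2.3376 ∧ gwDeriv θ = 0 ∧
    (∀ x, 0 < x → x < θ → gwDeriv x < 0) ∧ (∀ x, θ < x → x ≤ Real.pi → 0 < gwDeriv x) := by
  have hπ1 := Real.pi_gt_d2
  have hπ2 := Real.pi_lt_d2
  have hl : gwDeriv 2.325 < 0 := by
    rw [gwDeriv_neg_iff (by norm_num) (by linarith)]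
    nlinarith [neg_lt_cos_left]
  have hr : 0 < gwDeriv 2.3376 := by
    rw [gwDeriv_pos_iff (by norm_num) (by linarith)]
    nlinarith [cos_right_lt]
  obtain ⟨θ, hθ, hθ0⟩ := intermediate_value_Ioo (by norm_num : (2.325 : ℝ) ≤ 2.3376)
    continuous_gwDeriv.continuousOn ⟨hl, hr⟩
  have hm : θ ∈ Set.Icc (Real.pi / 2) Real.pi := ⟨by linarith [hθ.1], by linarith [hθ.2]⟩
  refine ⟨θ, hθ.1, hθ.2, hθ0, fun x hx hxθ => ?_, fun x hx hxπ => ?_⟩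
  · rcases le_total x (Real.pi / 2) with h | h
    · have := gwDeriv_strictAntiOn (Set.left_mem_Icc.2 (by linarith)) ⟨hx.le, h⟩ hx
      simpa [gwDeriv] using this
    · rw [← hθ0]
      exact gwDeriv_strictMonoOn ⟨h, by linarith [hm.2]⟩ hm hxθ
  · rw [← hθ0]
    exact gwDeriv_strictMonoOn hm ⟨by linarith [hm.1], hxπ⟩ hx

theorem cos_lt_one_of_mem_Ioc {x : ℝ} (h0 : 0 < x) (hπ : x ≤ Real.pi) : Real.cos x < 1 := by
  have := Real.strictAntiOn_cos (Set.left_mem_Icc.2 Real.pi_pos.le) ⟨h0.le, hπ⟩ h0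
  rwa [Real.cos_zero] at this

theorem hasDerivAt_div_one_sub_cos {x : ℝ} (h : Real.cos x < 1) :
    HasDerivAt (fun x : ℝ => 2 / Real.pi * (x / (1 - Real.cos x)))
      (2 / Real.pi * (gwDeriv x / (1 - Real.cos x) ^ 2)) x := by
  have h' := ((hasDerivAt_id x).div ((hasDerivAt_const x (1 : ℝ)).sub (Real.hasDerivAt_cos x))
    (by simp; linarith)).const_mul (2 / Real.pi)
  refine h'.congr_deriv ?_
  simp [gwDeriv]

/-- The Goemans–Williamson angle exists, is unique, and is the zero of `gwDeriv`. -/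
theorem exists_unique_gwAngle : ∃ θ : ℝ, 2.325 < θ ∧ θ < 2.3376 ∧ gwDeriv θ = 0 ∧
    ∀ x, IsGWAngle x ↔ x = θ := by
  obtain ⟨θ, h1, h2, h3, hneg, hpos⟩ := exists_gwDeriv_zero
  have hπ := Real.pi_gt_d2
  refine ⟨θ, h1, h2, h3, ?_⟩
  set f := fun x : ℝ => 2 / Real.pi * (x / (1 - Real.cos x)) with hf
  have hcont : ∀ x : ℝ, 0 < x → x ≤ Real.pi → ContinuousAt f x := fun x h0 hπ =>
    (hasDerivAt_div_one_sub_cos (cos_lt_one_of_mem_Ioc h0 hπ)).continuousAt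
  have hanti : StrictAntiOn f (Set.Ioc 0 θ) := by
    apply strictAntiOn_of_deriv_neg (convex_Ioc _ _)
    · exact fun x hx => (hcont x hx.1 (by linarith [hx.2])).continuousWithinAt
    · intro x hx
      rw [interior_Ioc] at hx
      have hc := cos_lt_one_of_mem_Ioc hx.1 (by linarith [hx.2])
      rw [(hasDerivAt_div_one_sub_cos hc).deriv]
      exact mul_neg_of_pos_of_neg (by positivity)
        (div_neg_of_neg_of_pos (hneg x hx.1 hx.2) (pow_pos (by linarith) 2))
  have hmono : StrictMonoOn f (Set.Icc θ Real.pi) := by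
    apply strictMonoOn_of_deriv_pos (convex_Icc _ _)
    · exact fun x hx => (hcont x (by linarith [hx.1]) hx.2).continuousWithinAt
    · intro x hx
      rw [interior_Icc] at hx
      have hc := cos_lt_one_of_mem_Ioc (by linarith [hx.1]) hx.2.le
      rw [(hasDerivAt_div_one_sub_cos hc).deriv]
      exact mul_pos (by positivity) (div_pos (hpos x hx.1 hx.2.le) (pow_pos (by linarith) 2))
  have hlt : ∀ x ∈ Set.Ioc 0 Real.pi, x ≠ θ → f θ < f x := by
    intro x hx hne
    rcases lt_or_gt_of_ne hne with h | h
    · exact hanti ⟨hx.1, h.le⟩ ⟨by linarith, le_rfl⟩ h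
    · exact hmono ⟨le_rfl, by linarith⟩ ⟨h.le, hx.2⟩ h
  have hθm : θ ∈ Set.Ioc 0 Real.pi := ⟨by linarith, by linarith⟩
  intro x
  constructor
  · rintro ⟨hx, hmin⟩
    by_contra hne
    exact absurd (hmin hθm) (not_le.2 (hlt x hx hne))
  · rintro rfl
    refine ⟨hθm, fun y hy => ?_⟩
    by_cases h : y = x
    · subst h; exact le_refl (f y)
    · exact (hlt y hy h).le

/-- The equation 1 - cos x = x sin x says tan(x/2) = x; here both strict inequalities of the sign
criteria are excluded. -/
theorem cos_eq_of_gwDeriv_eq_zero {x : ℝ} (h0 : 0 < x) (hπ : x < Real.pi) (h : gwDeriv x = 0) :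
    Real.cos x = (1 - x ^ 2) / (1 + x ^ 2) := by
  have h1 : ¬ _ := (gwDeriv_neg_iff h0 hπ).not.1 (by rw [h]; exact lt_irrefl 0)
  have h2 : ¬ _ := (gwDeriv_pos_iff h0 hπ).not.1 (by rw [h]; exact lt_irrefl 0)
  rw [eq_div_iff (by positivity)]
  linarith

theorem existsUnique_isGWAngle : ∃! θ : ℝ, IsGWAngle θ := by
  obtain ⟨θ, -, -, -, h⟩ := exists_unique_gwAngle
  exact ⟨θ, (h θ).2 rfl, fun x hx => (h x).1 hx⟩

theorem IsGWAngle.cos_bounds {θ : ℝ} (h : IsGWAngle θ) :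
    -0.6907 < Real.cos θ ∧ Real.cos θ < -0.6877 ∧ |1 / (1 - Real.cos θ) - 0.592| < 0.0005 := by
  obtain ⟨θ', h1, h2, h3, hiff⟩ := exists_unique_gwAngle
  obtain rfl := (hiff θ).1 h
  have hc := cos_eq_of_gwDeriv_eq_zero (by linarith) (by linarith [Real.pi_gt_d2]) h3
  have hl : (2.325 : ℝ) ^ 2 < θ ^ 2 := by nlinarith
  have hr : θ ^ 2 < (2.3376 : ℝ) ^ 2 := by nlinarith
  -- In this form the limit is monotone in θ², so the enclosure of θ transfers directly.
  have e : 1 / (1 - Real.cos θ) = 1 / 2 + 1 / (2 * θ ^ 2) := by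
    have : (1 : ℝ) + θ ^ 2 ≠ 0 := by positivity
    have : θ ^ 2 ≠ 0 := by nlinarith
    have h' : 1 - Real.cos θ = 2 * θ ^ 2 / (1 + θ ^ 2) := by rw [hc]; field_simp; ring
    rw [h']; field_simp; ring
  refine ⟨?_, ?_, ?_⟩
  · rw [hc, lt_div_iff₀ (by positivity)]; norm_num at hl hr ⊢; linarith
  · rw [hc, div_lt_iff₀ (by positivity)]; norm_num at hl hr ⊢; linarith
  · rw [e, abs_lt]
    have hp : (0 : ℝ) < 2 * θ ^ 2 := by linarith
    have a1 : (0.0915 : ℝ) < 1 / (2 * θ ^ 2) := by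
      rw [lt_div_iff₀ hp]; norm_num at hl hr ⊢; linarith
    have a2 : 1 / (2 * θ ^ 2) < (0.0925 : ℝ) := by
      rw [div_lt_iff₀ hp]; norm_num at hl hr ⊢; linarith
    constructor <;> norm_num at a1 a2 ⊢ <;> linarith

/-! ### Change of the cut value under bit flips. -/

section Cut

variable {V : Type*} [DecidableEq V]

/-- Flip the bit `v`. -/
def flipBit (v : V) (z : V → Bool) : V → Bool := Function.update z v (!(z v))

theorem flipBit_flipBit (v : V) (z : V → Bool) : flipBit v (flipBit v z) = z := by
  simp [flipBit]

theorem spin_not (a : Bool) : spin (!a) = -spin a := by cases a <;> simp [spin]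

theorem spin_mul_self (a : Bool) : spin a * spin a = 1 := by cases a <;> simp [spin]

theorem spin_flipBit_self (v : V) (z : V → Bool) : spin (flipBit v z v) = -spin (z v) := by
  simp [flipBit, spin_not]

theorem spin_flipBit_of_ne {v w : V} (h : w ≠ v) (z : V → Bool) :
    spin (flipBit v z w) = spin (z w) := by
  simp [flipBit, h]

theorem spin_flipBit (v w : V) (z : V → Bool) :
    spin (flipBit v z w) = spin (z w) - 2 * (if w = v then spin (z v) else 0) := by
  by_cases h : w = v
  · subst h; rw [spin_flipBit_self]; simp; ring
  · rw [spin_flipBit_of_ne h]; simp [h]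

variable [Fintype V] (G : SimpleGraph V) [DecidableRel G.Adj]

theorem SimpleGraph.sum_edgeFinset_lift (f : V → V → ℝ) (hf : ∀ i j, f i j = f j i) :
    ∑ e ∈ G.edgeFinset, Sym2.lift ⟨f, hf⟩ e
      = 1 / 2 * ∑ i, ∑ j, G.adjMatrix ℝ i j * f i j := by
  have h1 : ∑ d : G.Dart, Sym2.lift ⟨f, hf⟩ d.edge
      = 2 * ∑ e ∈ G.edgeFinset, Sym2.lift ⟨f, hf⟩ e := by
    rw [← Finset.sum_fiberwise_of_maps_to (t := G.edgeFinset) (g := fun d : G.Dart => d.edge)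
      (fun d _ => by simp), Finset.mul_sum]
    refine Finset.sum_congr rfl fun e he => ?_
    rw [Finset.sum_congr rfl (g := fun _ => Sym2.lift ⟨f, hf⟩ e)
      (fun d hd => by rw [(Finset.mem_filter.1 hd).2]), Finset.sum_const,
      G.dart_edge_fiber_card e (by simpa using he)]
    simp
  have h2 : ∑ d : G.Dart, Sym2.lift ⟨f, hf⟩ d.edge = ∑ i, ∑ j, G.adjMatrix ℝ i j * f i j := by
    rw [← Finset.sum_product', Finset.univ_product_univ]
    simp only [SimpleGraph.adjMatrix_apply, ite_mul, one_mul, zero_mul]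
    rw [← Finset.sum_filter]
    refine Finset.sum_bij (fun d _ => d.toProd) (fun d _ => by simp)
      (fun d _ d' _ h => SimpleGraph.Dart.ext _ _ h)
      (fun p hp => ⟨⟨p, by simpa using hp⟩, Finset.mem_univ _, rfl⟩) (fun d _ => rfl)
  rw [← h2, h1]; ring

theorem cutValue_eq_sum (z : V → Bool) :
    cutValue G z = 1 / 4 * ∑ i, ∑ j, G.adjMatrix ℝ i j * (1 - spin (z i) * spin (z j)) := by
  rw [cutValue, G.sum_edgeFinset_lift]; ring

theorem cutValue_sub_flipBit (v : V) (z : V → Bool) :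
    cutValue G z - cutValue G (flipBit v z)
      = -spin (z v) * ∑ l, G.adjMatrix ℝ v l * spin (z l) := by
  have key : ∀ k l, G.adjMatrix ℝ k l * (1 - spin (z k) * spin (z l))
      - G.adjMatrix ℝ k l * (1 - spin (flipBit v z k) * spin (flipBit v z l))
      = (if k = v then -2 * spin (z v) * (G.adjMatrix ℝ k l * spin (z l)) else 0)
        + (if l = v then -2 * spin (z v) * (G.adjMatrix ℝ k l * spin (z k)) else 0)
        + (if l = v then (if k = v then 4 * spin (z v) ^ 2 * G.adjMatrix ℝ k l else 0) else 0) := by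
    intro k l
    rw [spin_flipBit, spin_flipBit]
    split_ifs <;> ring
  rw [cutValue_eq_sum, cutValue_eq_sum, ← mul_sub, ← Finset.sum_sub_distrib]
  simp_rw [← Finset.sum_sub_distrib, key, Finset.sum_add_distrib]
  have e1 : ∑ k, ∑ l, (if k = v then -2 * spin (z v) * (G.adjMatrix ℝ k l * spin (z l)) else 0)
      = -2 * spin (z v) * ∑ l, G.adjMatrix ℝ v l * spin (z l) := by
    rw [Finset.sum_comm]
    simp [Finset.mul_sum]
  have e2 : ∑ k, ∑ l, (if l = v then -2 * spin (z v) * (G.adjMatrix ℝ k l * spin (z k)) else 0)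
      = -2 * spin (z v) * ∑ l, G.adjMatrix ℝ v l * spin (z l) := by
    simp [Finset.mul_sum, G.adj_comm]
  have e3 : ∑ k, ∑ l, (if l = v then
      (if k = v then 4 * spin (z v) ^ 2 * G.adjMatrix ℝ k l else 0) else 0) = 0 := by
    simp
  rw [e1, e2, e3]; ring

/-- Flipping both ends leaves x_i x_j unchanged, so the edge ij drops out and only the couplings to
the other vertices remain. -/
theorem cutValue_sub_flipBit_flipBit {i j : V} (hij : G.Adj i j) (z : V → Bool) :
    cutValue G z - cutValue G (flipBit j (flipBit i z))
      = -∑ l, if l = i ∨ l = j then 0 else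
          (G.adjMatrix ℝ i l * spin (z i) + G.adjMatrix ℝ j l * spin (z j)) * spin (z l) := by
  have hne := hij.ne
  rw [← sub_add_sub_cancel _ (cutValue G (flipBit i z)), cutValue_sub_flipBit,
    cutValue_sub_flipBit, spin_flipBit_of_ne hne.symm, Finset.mul_sum, Finset.mul_sum,
    ← Finset.sum_add_distrib, ← Finset.sum_neg_distrib]
  have key : ∀ l, -spin (z i) * (G.adjMatrix ℝ i l * spin (z l))
      + -spin (z j) * (G.adjMatrix ℝ j l * spin (flipBit i z l))
      = -(if l = i ∨ l = j then 0 else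
          (G.adjMatrix ℝ i l * spin (z i) + G.adjMatrix ℝ j l * spin (z j)) * spin (z l))
        + ((if l = i then spin (z j) * spin (z i) else 0)
          + (if l = j then -(spin (z j) * spin (z i)) else 0)) := by
    intro l
    rw [spin_flipBit]
    by_cases h1 : l = i
    · subst h1; simp [hne, hij.symm]; ring
    · by_cases h2 : l = j
      · subst h2; simp [hne.symm, hij]; ring
      · simp only [h1, h2, or_self, if_false]; ring
  simp_rw [key, Finset.sum_add_distrib]
  simp

end Cut

/-! ### Averages over uniformly random spins. -/

section Average

variable {V : Type*} [Fintype V] [DecidableEq V]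

/-- The mean of a function of a uniformly random bit string. -/
noncomputable def bitMean (F : (V → Bool) → ℂ) : ℂ := (∑ z, F z) / 2 ^ Fintype.card V

theorem bitMean_sum {ι : Type*} (s : Finset ι) (F : ι → (V → Bool) → ℂ) :
    bitMean (fun z => ∑ a ∈ s, F a z) = ∑ a ∈ s, bitMean (F a) := by
  simp [bitMean, Finset.sum_comm (t := s), Finset.sum_div]

/-- Independence of the bits: the mean of a product over vertices factorises. -/
theorem bitMean_prod (f : V → Bool → ℂ) :
    bitMean (fun z => ∏ v, f v (z v)) = ∏ v, (f v true + f v false) / 2 := by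
  have h : ∑ z : V → Bool, ∏ v, f v (z v) = ∏ v, (f v true + f v false) := by
    rw [← Fintype.piFinset_univ, ← Finset.prod_univ_sum]
    simp
  rw [bitMean, h, Finset.prod_div_distrib]
  simp

theorem bitMean_spin_mul_spin {i j : V} (hij : i ≠ j) :
    bitMean (fun z => (spin (z i) * spin (z j) : ℂ)) = 0 := by
  have h : (fun z : V → Bool => (spin (z i) * spin (z j) : ℂ))
      = fun z => ∏ v, ((if v = i then (spin (z v) : ℂ) else 1) *
        (if v = j then (spin (z v) : ℂ) else 1)) := by
    funext z
    rw [Finset.prod_mul_distrib]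
    simp
  rw [h, bitMean_prod (fun v t => (if v = i then (spin t : ℂ) else 1) *
        (if v = j then (spin t : ℂ) else 1))]
  apply Finset.prod_eq_zero (Finset.mem_univ i)
  simp [hij, spin]

variable (G : SimpleGraph V) [DecidableRel G.Adj]

theorem sum_spin_mul_exp (a : ℂ) :
    (spin true : ℂ) * Complex.exp (a * Complex.I * spin true)
      + spin false * Complex.exp (a * Complex.I * spin false) = 2 * (Complex.sin a * Complex.I) := by
  rw [Complex.sin]
  simp only [spin]
  simp
  linear_combination (-Complex.exp (-(a * Complex.I)) + Complex.exp (a * Complex.I)) * Complex.I_sq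

theorem sum_exp_spin (a : ℂ) :
    Complex.exp (a * Complex.I * spin true)
      + Complex.exp (a * Complex.I * spin false) = 2 * Complex.cos a := by
  rw [Complex.cos]
  simp only [spin]
  simp
  ring

theorem Complex.sin_mul_spin (a : ℂ) (t : Bool) :
    Complex.sin (a * spin t) = Complex.sin a * spin t := by
  cases t <;> simp [spin]

theorem Complex.cos_mul_spin (a : ℂ) (t : Bool) : Complex.cos (a * spin t) = Complex.cos a := by
  cases t <;> simp [spin]

theorem card_filter_adj_and_ne {i j : V} (hij : G.Adj i j) :
    (Finset.univ.filter fun v => G.Adj i v ∧ v ≠ j).card = G.degree i - 1 := by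
  rw [← G.card_neighborFinset_eq_degree, ← Finset.card_erase_of_mem (a := j) (by simpa using hij)]
  congr 1
  ext v
  simp [and_comm]

/-- The mean of `x_i x_j exp (i a x_i ∑_l A_il x_l)` over uniformly random spins. -/
theorem bitMean_single {i j : V} (hij : G.Adj i j) (a : ℂ) :
    bitMean (fun z => (spin (z i) * spin (z j) : ℂ) *
        Complex.exp (a * Complex.I * (spin (z i) * ∑ l, (G.adjMatrix ℝ i l * spin (z l) : ℝ))))
      = Complex.sin a * Complex.I * Complex.cos a ^ (G.degree i - 1) := by
  -- Conditioning on the value s of the spin at i makes the exponent linear in the remaining spins,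
  -- so each summand is a product over vertices.
  have h : (fun z : V → Bool => (spin (z i) * spin (z j) : ℂ) *
        Complex.exp (a * Complex.I * (spin (z i) * ∑ l, (G.adjMatrix ℝ i l * spin (z l) : ℝ))))
      = fun z => ∑ s : Bool, ∏ v, ((if v = i then (if z v = s then (spin s : ℂ) else 0) else 1) *
        (if v = j then (spin (z v) : ℂ) else 1) *
        Complex.exp (a * spin s * G.adjMatrix ℝ i v * Complex.I * spin (z v))) := by
    funext z
    simp_rw [Finset.prod_mul_distrib, ← Complex.exp_sum, Finset.prod_ite_eq' Finset.univ,
      Finset.mem_univ, if_true]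
    rw [Finset.sum_eq_single (z i) (fun s _ hs => by rw [if_neg hs.symm]; simp) (by simp), if_pos rfl]
    congr 2
    push_cast
    rw [Finset.mul_sum, Finset.mul_sum]
    refine Finset.sum_congr rfl fun l _ => ?_
    ring
  rw [h, bitMean_sum]
  have h2 : ∀ s : Bool, bitMean (fun z : V → Bool => ∏ v,
        ((if v = i then (if z v = s then (spin s : ℂ) else 0) else 1) *
        (if v = j then (spin (z v) : ℂ) else 1) *
        Complex.exp (a * spin s * G.adjMatrix ℝ i v * Complex.I * spin (z v))))
      = Complex.sin a * Complex.I * Complex.cos a ^ (G.degree i - 1) / 2 := by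
    intro s
    rw [bitMean_prod (fun v t => (if v = i then (if t = s then (spin s : ℂ) else 0) else 1) *
        (if v = j then (spin t : ℂ) else 1) *
        Complex.exp (a * spin s * G.adjMatrix ℝ i v * Complex.I * spin t))]
    have h3 : ∀ v, ((if v = i then (if true = s then (spin s : ℂ) else 0) else 1) *
        (if v = j then (spin true : ℂ) else 1) *
        Complex.exp (a * spin s * G.adjMatrix ℝ i v * Complex.I * spin true)
        + (if v = i then (if false = s then (spin s : ℂ) else 0) else 1) *
        (if v = j then (spin false : ℂ) else 1) *
        Complex.exp (a * spin s * G.adjMatrix ℝ i v * Complex.I * spin false)) / 2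
        = (if v = i then (spin s : ℂ) / 2 else 1) *
          (if v = j then Complex.sin a * spin s * Complex.I else 1) *
          (if G.Adj i v ∧ v ≠ j then Complex.cos a else 1) := by
      intro v
      by_cases h1 : v = i
      · subst h1
        cases s <;> simp [hij.ne]
      · by_cases h2 : v = j
        · subst h2
          simp only [h1, if_false, if_true, one_mul, SimpleGraph.adjMatrix_apply, hij,
            Complex.ofReal_one, mul_one, sum_spin_mul_exp, Complex.sin_mul_spin]
          simp
        · by_cases h3 : G.Adj i v
          · simp only [h1, h2, h3, if_false, if_true, one_mul, SimpleGraph.adjMatrix_apply,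
              Complex.ofReal_one, mul_one, sum_exp_spin, Complex.cos_mul_spin]
            simp [h2]
          · simp [h1, h2, h3]
    rw [Finset.prod_congr rfl fun v _ => h3 v, Finset.prod_mul_distrib, Finset.prod_mul_distrib,
      Finset.prod_ite_eq' Finset.univ, Finset.prod_ite_eq' Finset.univ, ← Finset.prod_filter,
      Finset.prod_const, card_filter_adj_and_ne G hij]
    have : (spin s * spin s : ℂ) = 1 := by exact_mod_cast spin_mul_self s
    simp only [Finset.mem_univ, if_true]
    linear_combination (Complex.sin a * Complex.I * Complex.cos a ^ (G.degree i - 1) / 2) * this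
  simp_rw [h2]
  simp
  ring

/-- The product over the vertices other than `i` and `j` of `cos (γ (A_iv + ε A_jv))`. -/
noncomputable def pairCos (γ ε : ℝ) (i j : V) : ℝ :=
  ∏ v, if v = i ∨ v = j then 1 else
    Real.cos (γ * (G.adjMatrix ℝ i v + ε * G.adjMatrix ℝ j v))

/-- Condition on both spins s at i and t at j. Averaging each remaining spin gives a cosine, which
by evenness depends only on the product st; the two signs of st yield the two `pairCos` terms. -/
theorem bitMean_pair {i j : V} (hij : i ≠ j) (γ : ℝ) :
    bitMean (fun z => (spin (z i) * spin (z j) : ℂ) *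
        Complex.exp (γ * Complex.I * (∑ l, if l = i ∨ l = j then 0 else
          (G.adjMatrix ℝ i l * spin (z i) + G.adjMatrix ℝ j l * spin (z j)) * spin (z l) : ℝ)))
      = ((pairCos G γ 1 i j - pairCos G γ (-1) i j) / 2 : ℝ) := by
  have h : (fun z : V → Bool => (spin (z i) * spin (z j) : ℂ) *
        Complex.exp (γ * Complex.I * (∑ l, if l = i ∨ l = j then 0 else
          (G.adjMatrix ℝ i l * spin (z i) + G.adjMatrix ℝ j l * spin (z j)) * spin (z l) : ℝ)))
      = fun z => ∑ p : Bool × Bool, ∏ v,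
        ((if v = i then (if z v = p.1 then (spin p.1 : ℂ) else 0) else 1) *
        (if v = j then (if z v = p.2 then (spin p.2 : ℂ) else 0) else 1) *
        Complex.exp ((if v = i ∨ v = j then 0 else
          γ * (G.adjMatrix ℝ i v * spin p.1 + G.adjMatrix ℝ j v * spin p.2) : ℝ)
            * Complex.I * spin (z v))) := by
    funext z
    simp_rw [Finset.prod_mul_distrib, ← Complex.exp_sum, Finset.prod_ite_eq' Finset.univ,
      Finset.mem_univ, if_true]
    rw [Finset.sum_eq_single (z i, z j) (fun s _ hs => by
      by_cases h1 : z i = s.1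
      · have h2 : z j ≠ s.2 := fun h2 => hs (Prod.ext h1.symm h2.symm)
        rw [if_neg h2]; simp
      · rw [if_neg h1]; simp) (by simp), if_pos rfl, if_pos rfl]
    congr 2
    push_cast
    rw [Finset.mul_sum]
    refine Finset.sum_congr rfl fun l _ => ?_
    split_ifs
    · simp
    · push_cast; ring
  rw [h, bitMean_sum]
  have h2 : ∀ p : Bool × Bool, bitMean (fun z : V → Bool => ∏ v,
        ((if v = i then (if z v = p.1 then (spin p.1 : ℂ) else 0) else 1) *
        (if v = j then (if z v = p.2 then (spin p.2 : ℂ) else 0) else 1) *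
        Complex.exp ((if v = i ∨ v = j then 0 else
          γ * (G.adjMatrix ℝ i v * spin p.1 + G.adjMatrix ℝ j v * spin p.2) : ℝ)
            * Complex.I * spin (z v))))
      = ((spin p.1 * spin p.2 / 4 * pairCos G γ (spin p.1 * spin p.2) i j : ℝ) : ℂ) := by
    intro p
    rw [bitMean_prod (fun v t => (if v = i then (if t = p.1 then (spin p.1 : ℂ) else 0) else 1) *
        (if v = j then (if t = p.2 then (spin p.2 : ℂ) else 0) else 1) *
        Complex.exp ((if v = i ∨ v = j then 0 else
          γ * (G.adjMatrix ℝ i v * spin p.1 + G.adjMatrix ℝ j v * spin p.2) : ℝ)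
            * Complex.I * spin t))]
    have h3 : ∀ v, ((if v = i then (if true = p.1 then (spin p.1 : ℂ) else 0) else 1) *
        (if v = j then (if true = p.2 then (spin p.2 : ℂ) else 0) else 1) *
        Complex.exp ((if v = i ∨ v = j then 0 else
          γ * (G.adjMatrix ℝ i v * spin p.1 + G.adjMatrix ℝ j v * spin p.2) : ℝ)
            * Complex.I * spin true)
        + (if v = i then (if false = p.1 then (spin p.1 : ℂ) else 0) else 1) *
        (if v = j then (if false = p.2 then (spin p.2 : ℂ) else 0) else 1) *
        Complex.exp ((if v = i ∨ v = j then 0 else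
          γ * (G.adjMatrix ℝ i v * spin p.1 + G.adjMatrix ℝ j v * spin p.2) : ℝ)
            * Complex.I * spin false)) / 2
        = (if v = i then (spin p.1 : ℂ) / 2 else 1) * (if v = j then (spin p.2 : ℂ) / 2 else 1) *
          ((if v = i ∨ v = j then 1 else Real.cos (γ * (G.adjMatrix ℝ i v +
            spin p.1 * spin p.2 * G.adjMatrix ℝ j v)) : ℝ) : ℂ) := by
      intro v
      obtain ⟨s, t⟩ := p
      by_cases h1 : v = i
      · subst h1
        cases s <;> simp [hij]
      · by_cases h2 : v = j
        · subst h2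
          cases t <;> simp [hij.symm]
        · have e : γ * (G.adjMatrix ℝ i v * spin s + G.adjMatrix ℝ j v * spin t)
              = γ * (G.adjMatrix ℝ i v + spin s * spin t * G.adjMatrix ℝ j v) * spin s := by
            linear_combination (-γ * G.adjMatrix ℝ j v * spin t) * spin_mul_self s
          simp only [h1, h2, or_self, if_false, one_mul, sum_exp_spin, e, Complex.ofReal_mul _ (spin s),
            Complex.cos_mul_spin, Complex.ofReal_cos]
          simp
    rw [Finset.prod_congr rfl fun v _ => h3 v, Finset.prod_mul_distrib, Finset.prod_mul_distrib,
      Finset.prod_ite_eq' Finset.univ, Finset.prod_ite_eq' Finset.univ, ← Complex.ofReal_prod,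
      ← pairCos]
    simp only [Finset.mem_univ, if_true]
    push_cast
    ring
  simp_rw [h2]
  simp only [Fintype.sum_prod_type, Fintype.sum_bool, spin]
  simp
  ring

end Average

/-! ### Exponentials of involutions. -/

section Exp

variable {n : Type*} [Fintype n] [DecidableEq n]

/-- Even powers of X are 1 and odd powers are X, so the series splits into those of cosh and sinh.
-/
theorem Matrix.exp_smul_of_sq_eq_one {X : Matrix n n ℂ} (hX : X * X = 1) (t : ℂ) :
    NormedSpace.exp (t • X) = Complex.cosh t • (1 : Matrix n n ℂ) + Complex.sinh t • X := by
  have h0 : ∀ k : ℕ, X ^ (2 * k) = 1 := fun k => by rw [pow_mul, pow_two, hX, one_pow]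
  have he : HasSum (fun k : ℕ => (((2 * k).factorial : ℚ)⁻¹) • (t • X) ^ (2 * k))
      (Complex.cosh t • (1 : Matrix n n ℂ)) := by
    have := (Complex.hasSum_cosh t).smul_const (1 : Matrix n n ℂ)
    convert this using 2 with k
    rw [smul_pow, h0, ← Rat.cast_smul_eq_qsmul ℂ, smul_smul]
    congr 1; push_cast; ring
  have ho : HasSum (fun k : ℕ => (((2 * k + 1).factorial : ℚ)⁻¹) • (t • X) ^ (2 * k + 1))
      (Complex.sinh t • X) := by
    have := (Complex.hasSum_sinh t).smul_const X
    convert this using 2 with k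
    rw [smul_pow, pow_succ X, h0, one_mul, ← Rat.cast_smul_eq_qsmul ℂ, smul_smul]
    congr 1; push_cast; ring
  rw [NormedSpace.exp_eq_tsum_rat]
  exact (he.even_add_odd (f := fun k : ℕ => ((k.factorial : ℚ)⁻¹) • (t • X) ^ k) ho).tsum_eq

theorem Matrix.exp_I_mul_smul_of_sq_eq_one {X : Matrix n n ℂ} (hX : X * X = 1) (t : ℝ) :
    NormedSpace.exp ((Complex.I * t) • X)
      = (Real.cos t : ℂ) • (1 : Matrix n n ℂ) + (Complex.I * Real.sin t) • X := by
  rw [Matrix.exp_smul_of_sq_eq_one hX, mul_comm, Complex.cosh_mul_I, Complex.sinh_mul_I]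
  push_cast
  rw [mul_comm Complex.I]

end Exp

/-! ### Pauli operators and conjugation by the mixer. -/

section Operators

variable {V : Type*} [Fintype V] [DecidableEq V]

theorem pauliX_mulVec (v : V) (ψ : (V → Bool) → ℂ) (z : V → Bool) :
    (pauliX V v *ᵥ ψ) z = ψ (flipBit v z) := by
  have : ∀ y : V → Bool, z = Function.update y v (!(y v)) ↔ y = flipBit v z := by
    intro y
    constructor
    · rintro rfl; exact (flipBit_flipBit v y).symm
    · rintro rfl; exact (flipBit_flipBit v z).symm
  simp only [Matrix.mulVec, dotProduct, pauliX, Matrix.of_apply, this]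
  simp

theorem pauliX_mul_self (v : V) : pauliX V v * pauliX V v = 1 := by
  refine Matrix.ext_of_mulVec_single fun i => ?_
  funext z
  rw [← Matrix.mulVec_mulVec, pauliX_mulVec, pauliX_mulVec, flipBit_flipBit, Matrix.one_mulVec]

theorem pauliX_commute (v w : V) : Commute (pauliX V v) (pauliX V w) := by
  rcases eq_or_ne v w with rfl | h
  · exact Commute.refl _
  refine Matrix.ext_of_mulVec_single fun i => ?_
  funext z
  rw [← Matrix.mulVec_mulVec, ← Matrix.mulVec_mulVec]
  simp only [pauliX_mulVec]
  congr 1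
  simp only [flipBit, Function.update_of_ne h, Function.update_of_ne h.symm]
  exact Function.update_comm h _ _ _

theorem pauliX_isHermitian (v : V) : (pauliX V v)ᴴ = pauliX V v := by
  ext x y
  have : y = Function.update x v (!(x v)) ↔ x = Function.update y v (!(y v)) := by
    constructor
    · rintro rfl; exact (flipBit_flipBit v x).symm
    · rintro rfl; exact (flipBit_flipBit v y).symm
  simp only [Matrix.conjTranspose_apply, pauliX, Matrix.of_apply, this]
  split_ifs <;> simp

/-- The operator `Z_i Z_j`. -/
def pauliZZ (i j : V) : Matrix (V → Bool) (V → Bool) ℂ :=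
  Matrix.diagonal fun z => (spin (z i) * spin (z j) : ℂ)

theorem pauliZZ_mul_self (i j : V) : pauliZZ i j * pauliZZ i j = 1 := by
  rw [pauliZZ, Matrix.diagonal_mul_diagonal, ← Matrix.diagonal_one]
  congr 1
  funext z
  have h1 : (spin (z i) * spin (z i) : ℂ) = 1 := by exact_mod_cast spin_mul_self (z i)
  have h2 : (spin (z j) * spin (z j) : ℂ) = 1 := by exact_mod_cast spin_mul_self (z j)
  linear_combination (spin (z j) * spin (z j) : ℂ) * h1 + h2

theorem pauliZZ_mulVec (i j : V) (ψ : (V → Bool) → ℂ) (z : V → Bool) :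
    (pauliZZ i j *ᵥ ψ) z = spin (z i) * spin (z j) * ψ z := by
  rw [pauliZZ, Matrix.mulVec_diagonal]

/-- Z_i Z_j anticommutes with X_i and X_j and commutes with every other X_v. -/
theorem pauliZZ_conj_pauliX {i j : V} (hij : i ≠ j) (v : V) :
    pauliZZ i j * pauliX V v * pauliZZ i j
      = pauliX V v - (if v = i then (2 : ℂ) • pauliX V v else 0)
        - (if v = j then (2 : ℂ) • pauliX V v else 0) := by
  refine Matrix.ext_of_mulVec_single fun k => ?_
  funext z
  rw [← Matrix.mulVec_mulVec, ← Matrix.mulVec_mulVec, pauliZZ_mulVec, pauliX_mulVec,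
    pauliZZ_mulVec]
  have h1 : (spin (z i) * spin (z i) : ℂ) = 1 := by exact_mod_cast spin_mul_self (z i)
  have h2 : (spin (z j) * spin (z j) : ℂ) = 1 := by exact_mod_cast spin_mul_self (z j)
  set ψ : (V → Bool) → ℂ := Pi.single k 1
  by_cases hi : v = i
  · subst hi
    rw [if_pos rfl, if_neg hij, spin_flipBit_self, spin_flipBit_of_ne hij.symm, sub_zero,
      Matrix.sub_mulVec, Pi.sub_apply, Matrix.smul_mulVec, Pi.smul_apply, pauliX_mulVec,
      smul_eq_mul]
    push_cast
    linear_combination (-(spin (z v) * spin (z v) : ℂ) * ψ (flipBit v z)) * h2 - ψ (flipBit v z) * h1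
  · by_cases hj : v = j
    · subst hj
      rw [if_pos rfl, if_neg hij.symm, spin_flipBit_self, spin_flipBit_of_ne hij, sub_zero,
        Matrix.sub_mulVec, Pi.sub_apply, Matrix.smul_mulVec, Pi.smul_apply, pauliX_mulVec,
        smul_eq_mul]
      push_cast
      linear_combination
        (-(spin (z v) * spin (z v) : ℂ) * ψ (flipBit v z)) * h1 - ψ (flipBit v z) * h2
    · rw [if_neg hi, if_neg hj, spin_flipBit_of_ne (Ne.symm hi), spin_flipBit_of_ne (Ne.symm hj),
        sub_zero, sub_zero, pauliX_mulVec]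
      linear_combination ((spin (z i) * spin (z i) : ℂ) * ψ (flipBit v z)) * h2
        + ψ (flipBit v z) * h1

theorem pauliZZ_conj_mixer {i j : V} (hij : i ≠ j) :
    pauliZZ i j * mixerHamiltonian V * pauliZZ i j
      = mixerHamiltonian V - (2 : ℂ) • pauliX V i - (2 : ℂ) • pauliX V j := by
  rw [mixerHamiltonian, Finset.mul_sum, Finset.sum_mul]
  simp_rw [pauliZZ_conj_pauliX hij, Finset.sum_sub_distrib]
  simp

theorem mixer_commute_pauliX (v : V) : Commute (mixerHamiltonian V) (pauliX V v) :=
  Commute.sum_left _ _ _ fun w _ => pauliX_commute w v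

theorem mixer_isHermitian : (mixerHamiltonian V)ᴴ = mixerHamiltonian V := by
  rw [mixerHamiltonian, Matrix.conjTranspose_sum]
  exact Finset.sum_congr rfl fun v _ => pauliX_isHermitian v

/-- The mixing unitary `exp (-i β B)`. -/
noncomputable def mixerUnitary (V : Type*) [Fintype V] [DecidableEq V] (β : ℝ) :
    Matrix (V → Bool) (V → Bool) ℂ :=
  NormedSpace.exp ((-Complex.I * (β : ℂ)) • mixerHamiltonian V)

theorem mixerUnitary_conjTranspose (β : ℝ) :
    (mixerUnitary V β)ᴴ = NormedSpace.exp ((Complex.I * (β : ℂ)) • mixerHamiltonian V) := by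
  rw [mixerUnitary, ← Matrix.exp_conjTranspose, Matrix.conjTranspose_smul, mixer_isHermitian]
  simp

theorem mixerUnitary_conjTranspose_mul (β : ℝ) :
    (mixerUnitary V β)ᴴ * mixerUnitary V β = 1 := by
  rw [mixerUnitary_conjTranspose, mixerUnitary, ← Matrix.exp_add_of_commute]
  · simp
  · exact ((Commute.refl (mixerHamiltonian V)).smul_left _).smul_right _

/-- Moving Z_i Z_j past exp(-iβB) changes only the signs of X_i and X_j in the exponent. All X_v
commute, so the B part cancels against the adjoint and exp(2iβX_i) exp(2iβX_j) is left. -/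
theorem mixerUnitary_conj_pauliZZ {i j : V} (hij : i ≠ j) (β : ℝ) :
    (mixerUnitary V β)ᴴ * pauliZZ i j * mixerUnitary V β
      = ((Real.cos (2 * β) : ℂ) • (1 : Matrix (V → Bool) (V → Bool) ℂ)
          + (Complex.I * Real.sin (2 * β)) • pauliX V i)
        * ((Real.cos (2 * β) : ℂ) • (1 : Matrix (V → Bool) (V → Bool) ℂ)
          + (Complex.I * Real.sin (2 * β)) • pauliX V j) * pauliZZ i j := by
  have hu : IsUnit (pauliZZ i j) :=
    ⟨⟨_, _, pauliZZ_mul_self i j, pauliZZ_mul_self i j⟩, rfl⟩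
  have hinv : (pauliZZ i j)⁻¹ = pauliZZ i j := Matrix.inv_eq_left_inv (pauliZZ_mul_self i j)
  have h1 : pauliZZ i j * mixerUnitary V β * pauliZZ i j
      = NormedSpace.exp ((-Complex.I * (β : ℂ)) • mixerHamiltonian V
        + (Complex.I * (2 * β : ℝ)) • (pauliX V i + pauliX V j)) := by
    have := Matrix.exp_conj (pauliZZ i j) ((-Complex.I * (β : ℂ)) • mixerHamiltonian V) hu
    rw [hinv] at this
    rw [mixerUnitary, ← this, Matrix.mul_smul, Matrix.smul_mul, pauliZZ_conj_mixer hij]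
    congr 1
    push_cast
    module
  have h2 : pauliZZ i j * mixerUnitary V β
      = pauliZZ i j * mixerUnitary V β * pauliZZ i j * pauliZZ i j := by
    rw [Matrix.mul_assoc _ (pauliZZ i j), pauliZZ_mul_self, Matrix.mul_one]
  rw [Matrix.mul_assoc, h2, h1, Matrix.exp_add_of_commute, ← mixerUnitary, ← Matrix.mul_assoc,
    ← Matrix.mul_assoc, mixerUnitary_conjTranspose_mul, Matrix.one_mul, smul_add,
    Matrix.exp_add_of_commute, Matrix.exp_I_mul_smul_of_sq_eq_one (pauliX_mul_self i),
    Matrix.exp_I_mul_smul_of_sq_eq_one (pauliX_mul_self j)]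
  · exact ((pauliX_commute i j).smul_left _).smul_right _
  · exact (((mixer_commute_pauliX i).add_right (mixer_commute_pauliX j)).smul_left _).smul_right _

end Operators

theorem pauliZZ_comm {V : Type*} [Fintype V] (i j : V) : pauliZZ i j = pauliZZ j i := by
  unfold pauliZZ
  congr 1
  funext z
  exact mul_comm _ _

/-! ### The depth-1 expected cut value. -/

section Expectation

variable {V : Type*} [Fintype V] [DecidableEq V]

/-- The linear functional `M ↦ ⟨φ| M |φ⟩`. -/
def stateMean (φ : (V → Bool) → ℂ) : Matrix (V → Bool) (V → Bool) ℂ →ₗ[ℂ] ℂ where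
  toFun M := star φ ⬝ᵥ (M *ᵥ φ)
  map_add' M N := by rw [Matrix.add_mulVec, dotProduct_add]
  map_smul' a M := by rw [Matrix.smul_mulVec, dotProduct_smul, RingHom.id_apply]

theorem stateMean_apply (φ : (V → Bool) → ℂ) (M : Matrix (V → Bool) (V → Bool) ℂ) :
    stateMean φ M = star φ ⬝ᵥ (M *ᵥ φ) := rfl

theorem stateMean_mulVec (φ : (V → Bool) → ℂ) (U M : Matrix (V → Bool) (V → Bool) ℂ) :
    stateMean (U *ᵥ φ) M = stateMean φ (Uᴴ * M * U) := by
  rw [stateMean_apply, stateMean_apply, Matrix.star_mulVec, ← Matrix.dotProduct_mulVec,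
    Matrix.mulVec_mulVec, Matrix.mulVec_mulVec, Matrix.mul_assoc]

variable (G : SimpleGraph V) [DecidableRel G.Adj]

/-- The state `exp (-i γ C) |+⟩`. -/
noncomputable def phaseState (γ : ℝ) : (V → Bool) → ℂ := fun z =>
  Complex.exp (-Complex.I * γ * cutValue G z) * (1 / Real.sqrt (2 ^ Fintype.card V) : ℝ)

theorem star_phaseState_mul {V : Type*} [Fintype V] (G : SimpleGraph V)
    [DecidableRel G.Adj] (γ : ℝ) (z z' : V → Bool) :
    star (phaseState G γ z) * phaseState G γ z'
      = Complex.exp (γ * Complex.I * (cutValue G z - cutValue G z' : ℝ)) / 2 ^ Fintype.card V := by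
  have h1 : star (phaseState G γ z) = Complex.exp (Complex.I * γ * cutValue G z)
      * (1 / Real.sqrt (2 ^ Fintype.card V) : ℝ) := by
    rw [phaseState, star_mul', Complex.star_def, ← Complex.exp_conj,
      Complex.conj_ofReal]
    simp
  have h2 : ((1 / Real.sqrt (2 ^ Fintype.card V) : ℝ) : ℂ) * (1 / Real.sqrt (2 ^ Fintype.card V) : ℝ)
      = 1 / 2 ^ Fintype.card V := by
    rw [← Complex.ofReal_mul, div_mul_div_comm, Real.mul_self_sqrt (by positivity)]
    simp
  rw [h1, phaseState, mul_mul_mul_comm, h2, ← Complex.exp_add, mul_one_div]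
  congr 2
  push_cast; ring

/-- All amplitudes of the phase state have the same modulus, so for an operator that relabels bit
strings and multiplies by a scalar the quantum expectation is a classical mean of phases. -/
theorem stateMean_phaseState (γ : ℝ) (M : Matrix (V → Bool) (V → Bool) ℂ) (f : (V → Bool) → (V → Bool))
    (a : (V → Bool) → ℂ) (hM : ∀ ψ z, (M *ᵥ ψ) z = a z * ψ (f z)) :
    stateMean (phaseState G γ) M
      = bitMean fun z => a z * Complex.exp (γ * Complex.I * (cutValue G z - cutValue G (f z) : ℝ)) := by
  rw [stateMean_apply, dotProduct, bitMean, Finset.sum_div]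
  refine Finset.sum_congr rfl fun z _ => ?_
  rw [hM, Pi.star_apply, mul_left_comm, star_phaseState_mul, mul_div_assoc]

theorem stateMean_one (γ : ℝ) : stateMean (phaseState G γ) 1 = 1 := by
  rw [stateMean_phaseState G γ 1 id (fun _ => 1) (by simp)]
  simp [bitMean]

theorem stateMean_pauliZZ (γ : ℝ) {i j : V} (hij : i ≠ j) :
    stateMean (phaseState G γ) (pauliZZ i j) = 0 := by
  rw [stateMean_phaseState G γ _ id _ (pauliZZ_mulVec i j)]
  simpa using bitMean_spin_mul_spin hij

theorem stateMean_pauliX_mul (γ : ℝ) {i j : V} (hij : G.Adj i j) :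
    stateMean (phaseState G γ) (pauliX V i * pauliZZ i j)
      = Real.sin γ * Complex.I * Real.cos γ ^ (G.degree i - 1) := by
  rw [stateMean_phaseState G γ _ (flipBit i) (fun z => -(spin (z i) * spin (z j)))]
  · have := bitMean_single G hij (-γ : ℂ)
    rw [Complex.sin_neg, Complex.cos_neg] at this
    push_cast
    have e : ∀ F : (V → Bool) → ℂ, bitMean (fun z => -F z) = -bitMean F := fun F => by
      simp [bitMean, neg_div]
    simp only [neg_mul]
    rw [e, eq_comm, ← neg_eq_iff_eq_neg, ← neg_mul, ← neg_mul, ← this]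
    congr 1
    funext z
    congr 2
    rw [← Complex.ofReal_sub, cutValue_sub_flipBit]
    push_cast; ring
  · intro ψ z
    rw [← Matrix.mulVec_mulVec, pauliX_mulVec, pauliZZ_mulVec, spin_flipBit_self,
      spin_flipBit_of_ne hij.ne.symm]
    push_cast; ring

theorem stateMean_pauliX_mul_pauliX_mul (γ : ℝ) {i j : V} (hij : G.Adj i j) :
    stateMean (phaseState G γ) (pauliX V i * pauliX V j * pauliZZ i j)
      = ((pairCos G γ 1 i j - pairCos G γ (-1) i j) / 2 : ℝ) := by
  rw [stateMean_phaseState G γ _ (fun z => flipBit j (flipBit i z))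
    (fun z => spin (z i) * spin (z j))]
  · have hneg : ∀ ε, pairCos G (-γ) ε i j = pairCos G γ ε i j := fun ε => by
      simp only [pairCos, neg_mul, Real.cos_neg]
    rw [← hneg, ← hneg, ← bitMean_pair G hij.ne]
    congr 1
    funext z
    rw [cutValue_sub_flipBit_flipBit G hij]
    congr 2
    rw [Complex.ofReal_neg, Complex.ofReal_neg]
    ring
  · intro ψ z
    rw [← Matrix.mulVec_mulVec, ← Matrix.mulVec_mulVec, pauliX_mulVec, pauliX_mulVec, pauliZZ_mulVec,
      spin_flipBit_self, spin_flipBit_of_ne hij.ne, spin_flipBit_self,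
      spin_flipBit_of_ne hij.ne.symm]
    push_cast; ring

/-- The correlation `⟨Z_i Z_j⟩` in the depth-`1` state, for an edge `ij`. -/
noncomputable def edgeCorrelation (γ β : ℝ) (i j : V) : ℝ :=
  -(Real.cos (2 * β) * Real.sin (2 * β) * Real.sin γ *
      (Real.cos γ ^ (G.degree i - 1) + Real.cos γ ^ (G.degree j - 1)))
    + Real.sin (2 * β) ^ 2 * ((pairCos G γ (-1) i j - pairCos G γ 1 i j) / 2)

theorem stateMean_mixer_conj (γ β : ℝ) {i j : V} (hij : G.Adj i j) :
    stateMean (phaseState G γ) ((mixerUnitary V β)ᴴ * pauliZZ i j * mixerUnitary V β)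
      = (edgeCorrelation G γ β i j : ℝ) := by
  rw [mixerUnitary_conj_pauliZZ hij.ne]
  have : ((Real.cos (2 * β) : ℂ) • (1 : Matrix (V → Bool) (V → Bool) ℂ)
          + (Complex.I * Real.sin (2 * β)) • pauliX V i)
        * ((Real.cos (2 * β) : ℂ) • (1 : Matrix (V → Bool) (V → Bool) ℂ)
          + (Complex.I * Real.sin (2 * β)) • pauliX V j) * pauliZZ i j
      = (Real.cos (2 * β) * Real.cos (2 * β) : ℂ) • pauliZZ i j
        + (Complex.I * Real.sin (2 * β) * Real.cos (2 * β)) • (pauliX V i * pauliZZ i j)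
        + (Complex.I * Real.sin (2 * β) * Real.cos (2 * β)) • (pauliX V j * pauliZZ j i)
        + (-(Real.sin (2 * β) * Real.sin (2 * β)) : ℂ) • (pauliX V i * pauliX V j * pauliZZ i j) := by
    rw [pauliZZ_comm j i]
    simp only [Matrix.add_mul, Matrix.mul_add, Matrix.smul_mul, Matrix.mul_smul, Matrix.one_mul,
      Matrix.mul_one]
    rw [show (-(Real.sin (2 * β) * Real.sin (2 * β)) : ℂ)
      = Complex.I * Real.sin (2 * β) * (Complex.I * Real.sin (2 * β)) by
        linear_combination (-(Real.sin (2 * β) * Real.sin (2 * β)) : ℂ) * Complex.I_sq]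
    module
  rw [this, map_add, map_add, map_add, map_smul, map_smul, map_smul, map_smul,
    stateMean_pauliZZ G γ hij.ne, stateMean_pauliX_mul G γ hij, stateMean_pauliX_mul G γ hij.symm,
    stateMean_pauliX_mul_pauliX_mul G γ hij, edgeCorrelation]
  simp only [smul_eq_mul]
  push_cast
  linear_combination (Complex.cos (2 * β) * Complex.sin (2 * β) * Complex.sin γ *
      (Complex.cos γ ^ (G.degree i - 1) + Complex.cos γ ^ (G.degree j - 1))) * Complex.I_sq

theorem costHamiltonian_eq_sum : costHamiltonian G
    = ∑ i, ∑ j, (1 / 4 * G.adjMatrix ℝ i j : ℂ) • (1 - pauliZZ i j) := by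
  ext x y
  simp only [Matrix.sum_apply, Matrix.smul_apply, Matrix.sub_apply, costHamiltonian, pauliZZ]
  rcases eq_or_ne x y with rfl | h
  · simp only [Matrix.diagonal_apply_eq, Matrix.one_apply_eq, cutValue_eq_sum, Finset.mul_sum]
    push_cast
    refine Finset.sum_congr rfl fun i _ => Finset.sum_congr rfl fun j _ => ?_
    simp only [smul_eq_mul]; ring
  · simp [h]

theorem qaoaState_one (γ β : Fin 1 → ℝ) :
    qaoaState G 1 γ β = mixerUnitary V (β 0) *ᵥ phaseState G (γ 0) := by
  have : NormedSpace.exp ((-Complex.I * (γ 0 : ℂ)) • costHamiltonian G) *ᵥ plusState V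
      = phaseState G (γ 0) := by
    rw [costHamiltonian, ← Matrix.diagonal_smul, Matrix.exp_diagonal]
    funext z
    rw [Matrix.mulVec_diagonal, Pi.coe_exp, phaseState, plusState, Complex.exp_eq_exp_ℂ]
    simp
  simp only [qaoaState, mixerUnitary]
  rw [← this]
  rfl

/-- The expected cut value of depth-`1` QAOA as a sum over ordered pairs of vertices. -/
theorem qaoaExpectation_one (γ β : Fin 1 → ℝ) : qaoaExpectation G 1 γ β
    = 1 / 4 * ∑ i, ∑ j, G.adjMatrix ℝ i j * (1 - edgeCorrelation G (γ 0) (β 0) i j) := by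
  rw [qaoaExpectation, ← stateMean_apply, qaoaState_one, stateMean_mulVec, costHamiltonian_eq_sum,
    Finset.mul_sum, Finset.sum_mul, map_sum, Finset.mul_sum, Complex.re_sum]
  refine Finset.sum_congr rfl fun i _ => ?_
  rw [Finset.mul_sum, Finset.sum_mul, map_sum, Finset.mul_sum, Complex.re_sum]
  refine Finset.sum_congr rfl fun j _ => ?_
  rw [Matrix.mul_smul, Matrix.smul_mul, map_smul]
  by_cases h : G.Adj i j
  · rw [Matrix.mul_sub, Matrix.sub_mul, map_sub, stateMean_mixer_conj G _ _ h, Matrix.mul_one,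
      mixerUnitary_conjTranspose_mul, stateMean_one, smul_eq_mul, SimpleGraph.adjMatrix_apply,
      if_pos h]
    rw [show (1 / 4 * (1 : ℝ) * (1 - edgeCorrelation G (γ 0) (β 0) i j) : ℂ)
      = ((1 / 4 * (1 - edgeCorrelation G (γ 0) (β 0) i j) : ℝ) : ℂ) by push_cast; ring,
      Complex.ofReal_re]
    ring
  · simp [h]

end Expectation

/-! ### Attainment of the maximum. -/

section Attained

variable {V : Type*} [Fintype V] [DecidableEq V] (G : SimpleGraph V) [DecidableRel G.Adj]

/-- The coefficients A_iv ± A_jv of γ are integers. -/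
theorem pairCos_periodic {ε : ℝ} (hε : ε = 1 ∨ ε = -1) (i j : V) (γ : ℝ) :
    pairCos G (γ + 2 * Real.pi) ε i j = pairCos G γ ε i j := by
  refine Finset.prod_congr rfl fun v _ => ?_
  obtain ⟨k, hk⟩ : ∃ k : ℤ, G.adjMatrix ℝ i v + ε * G.adjMatrix ℝ j v = k := by
    simp only [SimpleGraph.adjMatrix_apply]
    rcases hε with rfl | rfl <;> split_ifs
    · exact ⟨2, by norm_num⟩
    · exact ⟨1, by norm_num⟩
    · exact ⟨1, by norm_num⟩
    · exact ⟨0, by norm_num⟩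
    · exact ⟨0, by norm_num⟩
    · exact ⟨1, by norm_num⟩
    · exact ⟨-1, by norm_num⟩
    · exact ⟨0, by norm_num⟩
  rw [hk, show (γ + 2 * Real.pi) * (k : ℝ) = γ * k + k * (2 * Real.pi) by ring,
    Real.cos_add_int_mul_two_pi]

theorem edgeCorrelation_periodic_left (γ β : ℝ) (i j : V) :
    edgeCorrelation G (γ + 2 * Real.pi) β i j = edgeCorrelation G γ β i j := by
  simp only [edgeCorrelation, pairCos_periodic G (Or.inl rfl), pairCos_periodic G (Or.inr rfl),
    Real.sin_add_two_pi, Real.cos_add_two_pi]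

theorem edgeCorrelation_periodic_right (γ β : ℝ) (i j : V) :
    edgeCorrelation G γ (β + 2 * Real.pi) i j = edgeCorrelation G γ β i j := by
  have h : 2 * (β + 2 * Real.pi) = 2 * β + 2 * Real.pi + 2 * Real.pi := by ring
  simp only [edgeCorrelation, h, Real.sin_add_two_pi, Real.cos_add_two_pi]

theorem continuous_edgeCorrelation (i j : V) :
    Continuous fun q : ℝ × ℝ => edgeCorrelation G q.1 q.2 i j := by
  have h : ∀ ε, Continuous fun q : ℝ × ℝ => pairCos G q.1 ε i j := fun ε => by
    refine continuous_finsetProd _ fun v _ => ?_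
    split_ifs <;> fun_prop
  have h1 := h 1
  have h2 := h (-1)
  unfold edgeCorrelation
  fun_prop

/-- By periodicity the range of the expectation is already its image on the compact square [0, 2π]².
-/
theorem qaoaValue_one_isGreatest :
    IsGreatest (Set.range fun q : (Fin 1 → ℝ) × (Fin 1 → ℝ) => qaoaExpectation G 1 q.1 q.2)
      (qaoaValue G 1) := by
  set F : ℝ × ℝ → ℝ := fun q =>
    1 / 4 * ∑ i, ∑ j, G.adjMatrix ℝ i j * (1 - edgeCorrelation G q.1 q.2 i j) with hF
  have hcont : Continuous F := by
    have := continuous_edgeCorrelation G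
    fun_prop
  have hrange : (Set.range fun q : (Fin 1 → ℝ) × (Fin 1 → ℝ) => qaoaExpectation G 1 q.1 q.2)
      = F '' (Set.Icc 0 (2 * Real.pi) ×ˢ Set.Icc 0 (2 * Real.pi)) := by
    ext y
    constructor
    · rintro ⟨⟨γ, β⟩, rfl⟩
      have p1 : Function.Periodic (fun x => F (x, β 0)) (2 * Real.pi) := fun x => by
        simp only [hF, edgeCorrelation_periodic_left]
      obtain ⟨γ', hγ', e1⟩ := p1.exists_mem_Ico₀ Real.two_pi_pos (γ 0)
      have p2 : Function.Periodic (fun x => F (γ', x)) (2 * Real.pi) := fun x => by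
        simp only [hF, edgeCorrelation_periodic_right]
      obtain ⟨β', hβ', e2⟩ := p2.exists_mem_Ico₀ Real.two_pi_pos (β 0)
      refine ⟨(γ', β'), ⟨Set.Ico_subset_Icc_self hγ', Set.Ico_subset_Icc_self hβ'⟩, ?_⟩
      simp only at e1 e2 ⊢
      rw [← e2, ← e1, qaoaExpectation_one]
    · rintro ⟨⟨γ, β⟩, -, rfl⟩
      exact ⟨(fun _ => γ, fun _ => β), qaoaExpectation_one G _ _⟩
  have hc := (isCompact_Icc.prod isCompact_Icc).image (s := Set.Icc 0 (2 * Real.pi) ×ˢ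
    Set.Icc 0 (2 * Real.pi)) hcont
  have := hc.isGreatest_sSup ((Set.nonempty_Icc.2 Real.two_pi_pos.le).prod
    (Set.nonempty_Icc.2 Real.two_pi_pos.le) |>.image _)
  rw [← hrange] at this
  exact this

end Attained

/-! ### Bounds for QAOA on regular graphs. -/

section Regular

/-- With u = sin² γ, Bernoulli gives ku ≤ (1 + u)^k, and (1 + u)^k (1 - u)^k = (1 - u²)^k ≤ 1. -/
theorem sin_sq_mul_cos_sq_pow_le (γ : ℝ) (k : ℕ) :
    (k : ℝ) * (Real.sin γ ^ 2 * (Real.cos γ ^ 2) ^ k) ≤ 1 := by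
  set u := Real.sin γ ^ 2
  have hu0 : 0 ≤ u := sq_nonneg _
  have hc : Real.cos γ ^ 2 = 1 - u := by rw [Real.cos_sq']
  have hu1 : 0 ≤ 1 - u := hc ▸ sq_nonneg _
  have hb := one_add_mul_le_pow (by linarith : (-2 : ℝ) ≤ u) k
  rw [hc]
  calc (k : ℝ) * (u * (1 - u) ^ k) ≤ (1 + u) ^ k * (1 - u) ^ k := by
        nlinarith [pow_nonneg hu1 k]
    _ = (1 - u ^ 2) ^ k := by rw [← mul_pow]; ring
    _ ≤ 1 := pow_le_one₀ (by nlinarith) (by nlinarith)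

theorem abs_sin_mul_cos_pow_le (γ : ℝ) {k : ℕ} (hk : 0 < k) :
    |Real.sin γ * Real.cos γ ^ k| ≤ 1 / Real.sqrt k := by
  have hk' : (0 : ℝ) < k := by exact_mod_cast hk
  rw [le_div_iff₀ (Real.sqrt_pos.2 hk')]
  apply le_of_sq_le_sq _ zero_le_one
  rw [mul_pow, sq_abs, Real.sq_sqrt hk'.le, mul_pow, ← pow_mul, mul_comm k 2, pow_mul]
  linarith [sin_sq_mul_cos_sq_pow_le γ k]

variable {V : Type*} [Fintype V] [DecidableEq V] (G : SimpleGraph V) [DecidableRel G.Adj]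

/-- The two products differ only at common neighbours, where the factors are cos 2γ and 1. -/
theorem pairCos_one_abs_le (γ : ℝ) (i j : V) :
    |pairCos G γ 1 i j| ≤ |pairCos G γ (-1) i j| := by
  rw [pairCos, pairCos, Finset.abs_prod, Finset.abs_prod]
  refine Finset.prod_le_prod (fun _ _ => abs_nonneg _) fun v _ => ?_
  split_ifs
  · rfl
  · simp only [SimpleGraph.adjMatrix_apply]
    split_ifs <;> simp [Real.abs_cos_le_one]

/-- Only vertices adjacent to exactly one endpoint contribute, each a factor cos γ. By regularity
there are equally many on both sides, so the product is a square. -/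
theorem pairCos_neg_one_nonneg {d : ℕ} (hd : G.IsRegularOfDegree d) (γ : ℝ) {i j : V}
    (hij : G.Adj i j) : 0 ≤ pairCos G γ (-1) i j := by
  set I := (G.neighborFinset i).erase j with hI
  set J := (G.neighborFinset j).erase i with hJ
  have hcard : I.card = J.card := by
    rw [Finset.card_erase_of_mem (by simpa using hij),
      Finset.card_erase_of_mem (by simpa using hij.symm), G.card_neighborFinset_eq_degree,
      G.card_neighborFinset_eq_degree, hd i, hd j]
  have h : pairCos G γ (-1) i j = Real.cos γ ^ (I \ J).card * Real.cos γ ^ (J \ I).card := by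
    have key : ∀ v, (if v = i ∨ v = j then 1 else
        Real.cos (γ * (G.adjMatrix ℝ i v + (-1) * G.adjMatrix ℝ j v)))
        = (if v ∈ I \ J then Real.cos γ else 1) * (if v ∈ J \ I then Real.cos γ else 1) := by
      intro v
      simp only [hI, hJ, Finset.mem_sdiff, Finset.mem_erase, SimpleGraph.mem_neighborFinset,
        SimpleGraph.adjMatrix_apply]
      by_cases h1 : v = i
      · subst h1; simp
      by_cases h2 : v = j
      · subst h2; simp
      by_cases h3 : G.Adj i v <;> by_cases h4 : G.Adj j v <;> simp [h1, h2, h3, h4]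
    rw [pairCos, Finset.prod_congr rfl fun v _ => key v, Finset.prod_mul_distrib]
    simp only [Finset.prod_ite_mem, Finset.univ_inter, Finset.prod_const]
  rw [h, Finset.card_sdiff_comm hcard]
  exact mul_self_nonneg _

theorem neg_le_edgeCorrelation {d : ℕ} (hd : G.IsRegularOfDegree d) (hd2 : 2 ≤ d) (γ β : ℝ) {i j : V}
    (hij : G.Adj i j) : -(1 / Real.sqrt (d - 1 : ℕ)) ≤ edgeCorrelation G γ β i j := by
  have h1 := pairCos_neg_one_nonneg G hd γ hij
  have h2 := pairCos_one_abs_le G γ i j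
  rw [abs_of_nonneg h1] at h2
  have h3 := (le_abs_self _).trans h2
  have h4 := abs_sin_mul_cos_pow_le γ (k := d - 1) (by omega)
  have h5 : |2 * (Real.cos (2 * β) * Real.sin (2 * β))| ≤ 1 := by
    rw [show 2 * (Real.cos (2 * β) * Real.sin (2 * β)) = Real.sin (2 * (2 * β)) by
      rw [Real.sin_two_mul (2 * β)]; ring]
    exact Real.abs_sin_le_one _
  have h6 : 0 ≤ Real.sin (2 * β) ^ 2 * ((pairCos G γ (-1) i j - pairCos G γ 1 i j) / 2) :=
    mul_nonneg (sq_nonneg _) (by linarith)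
  have h7 : |2 * (Real.cos (2 * β) * Real.sin (2 * β)) * (Real.sin γ * Real.cos γ ^ (d - 1))|
      ≤ 1 / Real.sqrt (d - 1 : ℕ) := by
    rw [abs_mul]
    exact (mul_le_of_le_one_left (abs_nonneg _) h5).trans h4
  have h8 := (le_abs_self _).trans h7
  rw [edgeCorrelation, hd i, hd j]
  linarith

theorem sum_adjMatrix_of_isRegular {V : Type*} [Fintype V] (G : SimpleGraph V)
    [DecidableRel G.Adj] {d : ℕ} (hd : G.IsRegularOfDegree d) :
    ∑ i, ∑ j, G.adjMatrix ℝ i j = Fintype.card V * d := by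
  have : ∀ i, ∑ j, G.adjMatrix ℝ i j = d := fun i => by
    simp [SimpleGraph.adjMatrix_apply, ← hd i, ← G.card_neighborFinset_eq_degree,
      SimpleGraph.neighborFinset_eq_filter]
  rw [Finset.sum_congr rfl fun i _ => this i]
  simp

theorem qaoaValue_one_le {d : ℕ} (hd : G.IsRegularOfDegree d) (hd2 : 2 ≤ d) :
    qaoaValue G 1 ≤ Fintype.card V * d / 4 * (1 + 1 / Real.sqrt (d - 1 : ℕ)) := by
  obtain ⟨⟨γ, β⟩, h⟩ := (qaoaValue_one_isGreatest G).1
  have key : ∑ i, ∑ j, G.adjMatrix ℝ i j * (1 - edgeCorrelation G (γ 0) (β 0) i j)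
      ≤ Fintype.card V * d * (1 + 1 / Real.sqrt (d - 1 : ℕ)) := by
    rw [← sum_adjMatrix_of_isRegular G hd, Finset.sum_mul]
    refine Finset.sum_le_sum fun i _ => ?_
    rw [Finset.sum_mul]
    refine Finset.sum_le_sum fun j _ => ?_
    by_cases hij : G.Adj i j
    · simp only [SimpleGraph.adjMatrix_apply, if_pos hij, one_mul]
      linarith [neg_le_edgeCorrelation G hd hd2 (γ 0) (β 0) hij]
    · simp [hij]
  rw [← h]
  simp only
  rw [qaoaExpectation_one]
  linarith

/-- Zero angles leave the uniform superposition, which cuts half of the edges in expectation. -/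
theorem le_qaoaValue_one {d : ℕ} (hd : G.IsRegularOfDegree d) :
    Fintype.card V * d / 4 ≤ qaoaValue G 1 := by
  have h := (qaoaValue_one_isGreatest G).2 ⟨(fun _ => 0, fun _ => 0), rfl⟩
  refine le_trans (le_of_eq ?_) h
  simp only
  rw [qaoaExpectation_one, ← sum_adjMatrix_of_isRegular G hd]
  simp [edgeCorrelation]
  ring

end Regular

/-! ### Counting neighbours with prescribed elements. -/

section Counting

/-- The number of sets with prescribed numbers of elements inside and outside `S`, which contain
`I` and avoid `O`. -/
theorem card_filter_inter_inter {α : Type*} [Fintype α] [DecidableEq α] (S I O : Finset α)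
    (hdisj : Disjoint I O) {b c : ℕ} (hb : (S ∩ I).card ≤ b) (hc : (Sᶜ ∩ I).card ≤ c) :
    (Finset.univ.filter fun T : Finset α =>
        ((S ∩ T).card = b ∧ (Sᶜ ∩ T).card = c) ∧ I ⊆ T ∧ Disjoint O T).card
      = (S \ (I ∪ O)).card.choose (b - (S ∩ I).card)
        * (Sᶜ \ (I ∪ O)).card.choose (c - (Sᶜ ∩ I).card) := by
  rw [← Finset.card_powersetCard, ← Finset.card_powersetCard, ← Finset.card_product]
  have hdis : ∀ x, x ∈ I → x ∉ O := fun x h1 h2 => Finset.disjoint_left.1 hdisj h1 h2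
  have split : ∀ (R T : Finset α), I ⊆ T → Disjoint O T →
      (T ∩ (R \ (I ∪ O))).card + (R ∩ I).card = (R ∩ T).card := by
    intro R T hI hO
    rw [← Finset.card_union_of_disjoint]
    · congr 1
      ext x
      have h1 := @hI x
      have h2 : x ∈ O → x ∉ T := fun a b => Finset.disjoint_left.1 hO a b
      simp only [Finset.mem_union, Finset.mem_inter, Finset.mem_sdiff]
      tauto
    · rw [Finset.disjoint_left]
      intro x
      simp only [Finset.mem_union, Finset.mem_inter, Finset.mem_sdiff]
      tauto
  have back : ∀ (R P Q : Finset α), P ⊆ R \ (I ∪ O) → Disjoint Q R →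
      (R ∩ (P ∪ Q ∪ I)).card = P.card + (R ∩ I).card := by
    intro R P Q hP hQ
    rw [← Finset.card_union_of_disjoint]
    · congr 1
      ext x
      have h1 := @hP x
      have h2 : x ∈ Q → x ∉ R := fun a b => Finset.disjoint_left.1 hQ a b
      simp only [Finset.mem_union, Finset.mem_inter, Finset.mem_sdiff] at h1 ⊢
      tauto
    · rw [Finset.disjoint_left]
      intro x hx
      have := hP hx
      simp only [Finset.mem_union, Finset.mem_inter, Finset.mem_sdiff] at this ⊢
      tauto
  refine Finset.card_nbij' (fun T => (T ∩ (S \ (I ∪ O)), T ∩ (Sᶜ \ (I ∪ O))))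
    (fun P => P.1 ∪ P.2 ∪ I) ?_ ?_ ?_ ?_
  · intro T hT
    simp only [Finset.coe_filter, Finset.mem_univ, true_and, Set.mem_ofPred_eq] at hT
    obtain ⟨⟨h1, h2⟩, h3, h4⟩ := hT
    have e1 := split S T h3 h4
    have e2 := split Sᶜ T h3 h4
    simp only [Finset.coe_product, Set.mem_prod, Finset.mem_coe, Finset.mem_powersetCard]
    exact ⟨⟨Finset.inter_subset_right, by omega⟩, ⟨Finset.inter_subset_right, by omega⟩⟩
  · rintro ⟨P, Q⟩ hPQ
    simp only [Finset.coe_product, Set.mem_prod, Finset.mem_coe, Finset.mem_powersetCard] at hPQ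
    obtain ⟨⟨hP, hPc⟩, hQ, hQc⟩ := hPQ
    have hQS : Disjoint Q S := Finset.disjoint_left.2 fun x hx => by
      have := hQ hx
      simp only [Finset.mem_sdiff, Finset.mem_compl] at this
      exact this.1
    have hPS : Disjoint P Sᶜ := Finset.disjoint_left.2 fun x hx => by
      have := hP hx
      simp only [Finset.mem_sdiff] at this
      simpa using this.1
    have e1 := back S P Q hP hQS
    have e2 := back Sᶜ Q P hQ hPS
    rw [Finset.union_comm Q P] at e2
    simp only [Finset.coe_filter, Finset.mem_univ, true_and, Set.mem_ofPred_eq]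
    refine ⟨⟨by omega, by omega⟩, Finset.subset_union_right, Finset.disjoint_left.2 fun x hx => ?_⟩
    have h1 := @hP x
    have h2 := @hQ x
    have h3 := hdis x
    simp only [Finset.mem_union, Finset.mem_sdiff] at h1 h2 ⊢
    tauto
  · intro T hT
    simp only [Finset.coe_filter, Finset.mem_univ, true_and, Set.mem_ofPred_eq] at hT
    ext x
    have h1 := @hT.2.1 x
    have h2 : x ∈ O → x ∉ T := fun a b => Finset.disjoint_left.1 hT.2.2 a b
    simp only [Finset.mem_union, Finset.mem_inter, Finset.mem_sdiff, Finset.mem_compl]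
    tauto
  · rintro ⟨P, Q⟩ hPQ
    simp only [Finset.coe_product, Set.mem_prod, Finset.mem_coe, Finset.mem_powersetCard] at hPQ
    refine Prod.ext ?_ ?_
    all_goals
      ext x
      have h1 := @hPQ.1.1 x
      have h2 := @hPQ.2.1 x
      simp only [Finset.mem_union, Finset.mem_inter, Finset.mem_sdiff, Finset.mem_compl] at h1 h2 ⊢
      tauto

variable {m t b : ℕ}

/-- The number of neighbours of `S` that contain `I` and avoid `O`. -/
def nbrCount (b : ℕ) (S : {S : Finset (Fin m) // S.card = t}) (I O : Finset (Fin m)) : ℕ :=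
  (Finset.univ.filter fun T : {S : Finset (Fin m) // S.card = t} =>
    (karloffJ m t b).Adj S T ∧ I ⊆ T.1 ∧ Disjoint O T.1).card

/-- Since b < t, distinctness is automatic; recording the part of T outside S as well lets the two
halves be chosen independently. -/
theorem karloffJ_adj_iff (hbt : b < t) (S T : {S : Finset (Fin m) // S.card = t}) :
    (karloffJ m t b).Adj S T ↔ (S.1 ∩ T.1).card = b ∧ (S.1ᶜ ∩ T.1).card = t - b := by
  have h : (S.1 ∩ T.1).card + (S.1ᶜ ∩ T.1).card = t := by
    refine Eq.trans ?_ T.2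
    rw [← Finset.card_union_of_disjoint, ← Finset.union_inter_distrib_right]
    · simp
    · exact (disjoint_compl_right.mono Finset.inter_subset_left Finset.inter_subset_left)
  constructor
  · rintro ⟨-, h1⟩
    exact ⟨h1, by omega⟩
  · rintro ⟨h1, -⟩
    refine ⟨?_, h1⟩
    rintro rfl
    rw [Finset.inter_self, S.2] at h1
    omega

theorem nbrCount_eq (hbt : b < t) (S : {S : Finset (Fin m) // S.card = t}) (I O : Finset (Fin m))
    (hdisj : Disjoint I O) (hb : (S.1 ∩ I).card ≤ b) (hc : (S.1ᶜ ∩ I).card ≤ t - b) :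
    nbrCount b S I O = (S.1 \ (I ∪ O)).card.choose (b - (S.1 ∩ I).card)
        * (S.1ᶜ \ (I ∪ O)).card.choose (t - b - (S.1ᶜ ∩ I).card) := by
  rw [← card_filter_inter_inter S.1 I O hdisj hb hc, nbrCount]
  refine Finset.card_bij (fun T _ => T.1) ?_ (fun _ _ _ _ h => Subtype.ext h) ?_
  · intro T hT
    simpa [karloffJ_adj_iff hbt] using hT
  · intro T hT
    simp only [Finset.mem_filter, Finset.mem_univ, true_and] at hT
    have hcard : T.card = t := by
      have h : (S.1 ∩ T).card + (S.1ᶜ ∩ T).card = T.card := by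
        rw [← Finset.card_union_of_disjoint, ← Finset.union_inter_distrib_right]
        · simp
        · exact (disjoint_compl_right.mono Finset.inter_subset_left Finset.inter_subset_left)
      omega
    exact ⟨⟨T, hcard⟩, by simpa [karloffJ_adj_iff hbt] using hT, rfl⟩

theorem card_compl_slice (hm : m = 2 * t) (S : {S : Finset (Fin m) // S.card = t}) :
    (S.1ᶜ).card = t := by
  rw [Finset.card_compl, Fintype.card_fin, S.2]; omega

theorem karloffJ_isRegular (hm : m = 2 * t) (hbt : b < t) :
    (karloffJ m t b).IsRegularOfDegree (t.choose b ^ 2) := by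
  intro S
  have := nbrCount_eq hbt S ∅ ∅ (by simp) (by simp) (by simp)
  simp only [Finset.union_empty, Finset.sdiff_empty, Finset.inter_empty, Finset.card_empty,
    Nat.sub_zero, S.2, card_compl_slice hm, Nat.choose_symm hbt.le] at this
  rw [pow_two, ← this, ← SimpleGraph.card_neighborFinset_eq_degree,
    SimpleGraph.neighborFinset_eq_filter, nbrCount]
  simp

theorem nbrCount_singles (hm : m = 2 * t) (hb : 1 ≤ b) (hbt : b < t)
    (S : {S : Finset (Fin m) // S.card = t}) {a a' : Fin m} (ha : a ∈ S.1) (ha' : a' ∉ S.1) :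
    nbrCount b S {a} {a'} = (t - 1).choose (b - 1) ^ 2 ∧
      nbrCount b S {a'} {a} = (t - 1).choose b ^ 2 := by
  have hne : a ≠ a' := fun h => ha' (h ▸ ha)
  have hS := S.2
  have hSc := card_compl_slice hm S
  have h1 : S.1 ∩ {a} = {a} := by simpa using ha
  have h2 : S.1 ∩ {a'} = ∅ := Finset.inter_singleton_of_notMem ha'
  have h3 : S.1ᶜ ∩ {a} = ∅ := Finset.inter_singleton_of_notMem (by simpa using ha)
  have h4 : S.1ᶜ ∩ {a'} = {a'} := by simpa using ha'
  have c1 : (S.1 \ ({a} ∪ {a'})).card = t - 1 := by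
    rw [Finset.card_sdiff, Finset.union_inter_distrib_right, Finset.inter_comm _ S.1,
      Finset.inter_comm _ S.1, h1, h2, hS]; simp
  have c2 : (S.1ᶜ \ ({a} ∪ {a'})).card = t - 1 := by
    rw [Finset.card_sdiff, Finset.union_inter_distrib_right, Finset.inter_comm _ S.1ᶜ,
      Finset.inter_comm _ S.1ᶜ, h3, h4, hSc]; simp
  constructor
  · rw [nbrCount_eq hbt S _ _ (by simpa using hne) (by simp [h1, hb]) (by simp [h3]),
      c1, c2, h1, h3, Finset.card_singleton, Finset.card_empty, pow_two,
      Nat.choose_symm_of_eq_add (n := t - 1) (a := t - b - 0) (b := b - 1) (by omega)]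
  · rw [nbrCount_eq hbt S _ _ (by simpa using hne.symm) (by simp [h2]) (by simp [h4]; omega),
      Finset.union_comm, c1, c2, h2, h4, Finset.card_singleton, Finset.card_empty, pow_two,
      Nat.choose_symm_of_eq_add (n := t - 1) (a := t - b - 1) (b := b) (by omega), Nat.sub_zero]

theorem nbrCount_pairs (hm : m = 2 * t) (hb : 2 ≤ b) (hbt : b + 2 ≤ t)
    (S : {S : Finset (Fin m) // S.card = t}) {a a' c c' : Fin m} (ha : a ∈ S.1) (ha' : a' ∉ S.1)
    (hc : c ∈ S.1) (hc' : c' ∉ S.1) (hac : a ≠ c) (hac' : a' ≠ c') :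
    nbrCount b S {a, c} {a', c'} = (t - 2).choose (b - 2) ^ 2 ∧
    nbrCount b S {a, c'} {a', c} = (t - 2).choose (b - 1) ^ 2 ∧
    nbrCount b S {a', c} {a, c'} = (t - 2).choose (b - 1) ^ 2 ∧
    nbrCount b S {a', c'} {a, c} = (t - 2).choose b ^ 2 := by
  have n1 : a ≠ a' := fun h => ha' (h ▸ ha)
  have n2 : c ≠ c' := fun h => hc' (h ▸ hc)
  have n3 : a ≠ c' := fun h => hc' (h ▸ ha)
  have n4 : c ≠ a' := fun h => ha' (h ▸ hc)
  have hS := S.2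
  have hSc := card_compl_slice hm S
  have hbt' : b < t := by omega
  have c1 : (S.1 \ {a, c}).card = t - 2 := by
    rw [Finset.card_sdiff_of_subset (by intro x; simp; rintro (rfl | rfl) <;> assumption), hS,
      Finset.card_pair hac]
  have c2 : (S.1ᶜ \ {a', c'}).card = t - 2 := by
    rw [Finset.card_sdiff_of_subset (by intro x; simp; rintro (rfl | rfl) <;> assumption), hSc,
      Finset.card_pair hac']
  have key : ∀ I O : Finset (Fin m), I ∪ O = {a, c} ∪ {a', c'} →
      (S.1 \ (I ∪ O)).card = t - 2 ∧ (S.1ᶜ \ (I ∪ O)).card = t - 2 := by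
    intro I O h
    rw [h]
    refine ⟨(congrArg _ ?_).trans c1, (congrArg _ ?_).trans c2⟩
    · ext x
      simp only [Finset.mem_sdiff, Finset.mem_union, Finset.mem_insert, Finset.mem_singleton]
      constructor
      · tauto
      · rintro ⟨h1, h2⟩
        refine ⟨h1, ?_⟩
        rintro (h | rfl | rfl) <;> tauto
    · ext x
      simp only [Finset.mem_sdiff, Finset.mem_union, Finset.mem_insert, Finset.mem_singleton,
        Finset.mem_compl]
      constructor
      · tauto
      · rintro ⟨h1, h2⟩
        refine ⟨h1, ?_⟩
        rintro ((rfl | rfl) | h) <;> tauto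
  have main : ∀ (I O : Finset (Fin m)) (k l : ℕ), Disjoint I O → I ∪ O = {a, c} ∪ {a', c'} →
      (S.1 ∩ I).card = k → (S.1ᶜ ∩ I).card = l → k + l = 2 →
      nbrCount b S I O = (t - 2).choose (b - k) ^ 2 := by
    intro I O k l hd hu hk hl hkl
    rw [nbrCount_eq hbt' S I O hd (by omega) (by omega), (key I O hu).1, (key I O hu).2, hk, hl,
      pow_two, Nat.choose_symm_of_eq_add (n := t - 2) (a := t - b - l) (b := b - k) (by omega)]
  refine ⟨main _ _ 2 0 ?_ rfl ?_ ?_ rfl, main _ _ 1 1 ?_ ?_ ?_ ?_ rfl, main _ _ 1 1 ?_ ?_ ?_ ?_ rfl,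
    main _ _ 0 2 ?_ ?_ ?_ ?_ rfl⟩
  all_goals first
    | (simp [Finset.inter_insert_of_mem, Finset.inter_insert_of_notMem, ha, ha', hc, hc', hac, hac',
        n1, n2, n3, n4, n1.symm, n2.symm, n3.symm, n4.symm, hac.symm, hac'.symm]; done)
    | (ext x; simp only [Finset.mem_union, Finset.mem_insert, Finset.mem_singleton]; tauto)

end Counting

/-! ### Permutations acting on the vertices. -/

section SliceAction

variable {m t b : ℕ}

/-- The image of a `t`-element set under a permutation. -/
def permSlice (σ : Equiv.Perm (Fin m)) :
    Equiv.Perm {S : Finset (Fin m) // S.card = t} where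
  toFun S := ⟨S.1.map σ.toEmbedding, by rw [Finset.card_map, S.2]⟩
  invFun S := ⟨S.1.map σ.symm.toEmbedding, by rw [Finset.card_map, S.2]⟩
  left_inv S := by ext x; simp
  right_inv S := by ext x; simp

theorem mem_permSlice (σ : Equiv.Perm (Fin m)) (S : {S : Finset (Fin m) // S.card = t}) (x : Fin m) :
    x ∈ (permSlice σ S).1 ↔ σ.symm x ∈ S.1 := by
  simp [permSlice, Finset.mem_map_equiv]

theorem permSlice_adj (σ : Equiv.Perm (Fin m)) (S T : {S : Finset (Fin m) // S.card = t}) :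
    (karloffJ m t b).Adj (permSlice σ S) (permSlice σ T) ↔ (karloffJ m t b).Adj S T := by
  simp only [karloffJ, ne_eq, EmbeddingLike.apply_eq_iff_eq]
  simp only [permSlice, Equiv.coe_fn_mk, ← Finset.map_inter, Finset.card_map]

theorem permSlice_swap_swap (a a' : Fin m) (S : {S : Finset (Fin m) // S.card = t}) :
    permSlice (Equiv.swap a a') (permSlice (Equiv.swap a a') S) = S := by
  ext x; simp [mem_permSlice]

theorem permSlice_swap_eq_self {a a' : Fin m} {S : {S : Finset (Fin m) // S.card = t}}
    (h : a ∈ S.1 ↔ a' ∈ S.1) : permSlice (Equiv.swap a a') S = S := by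
  ext x
  rw [mem_permSlice, Equiv.symm_swap]
  by_cases h1 : x = a
  · subst h1; rw [Equiv.swap_apply_left]; exact h.symm
  by_cases h2 : x = a'
  · subst h2; rw [Equiv.swap_apply_right]; exact h
  rw [Equiv.swap_apply_of_ne_of_ne h1 h2]

theorem permSlice_swap_comm {a a' c c' : Fin m} (h1 : a ≠ c) (h2 : a ≠ c') (h3 : a' ≠ c)
    (h4 : a' ≠ c') (S : {S : Finset (Fin m) // S.card = t}) :
    permSlice (Equiv.swap a a') (permSlice (Equiv.swap c c') S)
      = permSlice (Equiv.swap c c') (permSlice (Equiv.swap a a') S) := by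
  have hd : ∀ x, Equiv.swap c c' (Equiv.swap a a' x) = Equiv.swap a a' (Equiv.swap c c' x) := by
    intro x
    by_cases e1 : x = a
    · subst e1; simp [Equiv.swap_apply_of_ne_of_ne, h1, h2, h3, h4]
    by_cases e2 : x = a'
    · subst e2; simp [Equiv.swap_apply_of_ne_of_ne, h1, h2, h3, h4]
    by_cases e3 : x = c
    · subst e3; simp [Equiv.swap_apply_of_ne_of_ne, h1.symm, h2.symm, h3.symm, h4.symm]
    by_cases e4 : x = c'
    · subst e4; simp [Equiv.swap_apply_of_ne_of_ne, h1.symm, h2.symm, h3.symm, h4.symm]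
    simp [Equiv.swap_apply_of_ne_of_ne, e1, e2, e3, e4]
  ext x
  simp only [mem_permSlice, Equiv.symm_swap, hd]

/-- A function on the slice that is invariant under the transpositions of a set `W` only depends
on the part of its argument outside `W`. -/
theorem eq_of_swap_invariant (W : Set (Fin m)) (f : {S : Finset (Fin m) // S.card = t} → ℝ)
    (hf : ∀ c ∈ W, ∀ d ∈ W, ∀ S, f (permSlice (Equiv.swap c d) S) = f S)
    (S T : {S : Finset (Fin m) // S.card = t}) (hST : ∀ x ∈ S.1, x ∉ T.1 → x ∈ W)
    (hTS : ∀ x ∈ T.1, x ∉ S.1 → x ∈ W) : f S = f T := by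
  -- Swapping an element of S \ T with one of T \ S stays within W and brings S one step closer to
  -- T.
  induction hk : (S.1 \ T.1).card generalizing S with
  | zero =>
    congr 1
    apply Subtype.ext
    apply Finset.eq_of_subset_of_card_le
    · rwa [← Finset.sdiff_eq_empty_iff_subset, ← Finset.card_eq_zero]
    · rw [S.2, T.2]
  | succ k ih =>
    have hc2 : (T.1 \ S.1).card = k + 1 := by
      rw [← hk]; exact Finset.card_sdiff_comm (by rw [S.2, T.2])
    obtain ⟨c, hc⟩ := Finset.card_pos.1 (by omega : 0 < (S.1 \ T.1).card)
    obtain ⟨d, hd⟩ := Finset.card_pos.1 (by omega : 0 < (T.1 \ S.1).card)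
    rw [Finset.mem_sdiff] at hc hd
    have hcW := hST c hc.1 hc.2
    have hdW := hTS d hd.1 hd.2
    rw [← hf c hcW d hdW S]
    have hmem : ∀ x, x ∈ (permSlice (Equiv.swap c d) S).1 ↔ x = d ∨ (x ≠ c ∧ x ∈ S.1) := by
      intro x
      rw [mem_permSlice, Equiv.symm_swap]
      by_cases h1 : x = c
      · subst h1
        rw [Equiv.swap_apply_left]
        have : x ≠ d := fun h => hd.2 (h ▸ hc.1)
        simp [this, hd.2]
      by_cases h2 : x = d
      · subst h2; rw [Equiv.swap_apply_right]; simp [hc.1]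
      rw [Equiv.swap_apply_of_ne_of_ne h1 h2]; simp [h1, h2]
    apply ih
    · intro x hx hxT
      rcases (hmem x).1 hx with rfl | ⟨-, h⟩
      · exact hdW
      · exact hST x h hxT
    · intro x hx hxS
      rw [hmem] at hxS
      push Not at hxS
      by_cases h : x = c
      · rwa [h]
      · exact hTS x hx (hxS.2 h)
    · have : (permSlice (Equiv.swap c d) S).1 \ T.1 = (S.1 \ T.1).erase c := by
        ext x
        rw [Finset.mem_sdiff, hmem, Finset.mem_erase, Finset.mem_sdiff]
        constructor
        · rintro ⟨rfl | ⟨h1, h2⟩, h3⟩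
          · exact absurd hd.1 h3
          · exact ⟨h1, h2, h3⟩
        · rintro ⟨h1, h2, h3⟩
          exact ⟨Or.inr ⟨h1, h2⟩, h3⟩
      rw [this, Finset.card_erase_of_mem (Finset.mem_sdiff.2 hc), hk]; rfl

end SliceAction

/-! ### Lower bound for the adjacency eigenvalues. -/

section Eigen

variable {m t b : ℕ}

/-- `f` satisfies the eigenvector equation `A f = l f` for the adjacency matrix `A` of
`J(m, t, b)`. -/
def IsEigen (b : ℕ) (l : ℝ) (f : {S : Finset (Fin m) // S.card = t} → ℝ) : Prop :=
  ∀ S, ∑ T, (karloffJ m t b).adjMatrix ℝ S T * f T = l * f S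

theorem IsEigen.permSlice {l : ℝ} {f : {S : Finset (Fin m) // S.card = t} → ℝ} (h : IsEigen b l f)
    (σ : Equiv.Perm (Fin m)) : IsEigen b l fun S => f (permSlice σ S) := by
  intro S
  rw [← h (_root_.permSlice σ S), ← Equiv.sum_comp (_root_.permSlice σ)
    fun T => (karloffJ m t b).adjMatrix ℝ (_root_.permSlice σ S) T * f T]
  refine Finset.sum_congr rfl fun T _ => ?_
  simp only [SimpleGraph.adjMatrix_apply, permSlice_adj]

theorem IsEigen.sub {l : ℝ} {f g : {S : Finset (Fin m) // S.card = t} → ℝ} (hf : IsEigen b l f)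
    (hg : IsEigen b l g) : IsEigen b l fun S => f S - g S := by
  intro S
  simp only [mul_sub, Finset.sum_sub_distrib, hf S, hg S]

theorem sum_adjMatrix_mul_indicator (S : {S : Finset (Fin m) // S.card = t}) (I O : Finset (Fin m)) :
    ∑ T, (karloffJ m t b).adjMatrix ℝ S T * (if I ⊆ T.1 ∧ Disjoint O T.1 then 1 else 0)
      = nbrCount b S I O := by
  rw [nbrCount, Finset.card_filter]
  push_cast
  refine Finset.sum_congr rfl fun T _ => ?_
  by_cases h : (karloffJ m t b).Adj S T <;> simp [h]

/-- The symmetries force g to be a multiple of the indicator of sets containing a but not a', minus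
the same with a and a' exchanged. The eigenvector equation at S then reads off l. -/
theorem eigenvalue_eq_of_antisymm (hm : m = 2 * t) (hb : 1 ≤ b) (hbt : b < t) {l : ℝ}
    {g : {S : Finset (Fin m) // S.card = t} → ℝ} (hg : IsEigen b l g) {a a' : Fin m}
    (hanti : ∀ T, g (permSlice (Equiv.swap a a') T) = -g T)
    (hinv : ∀ c ∈ ({a, a'}ᶜ : Set (Fin m)), ∀ d ∈ ({a, a'}ᶜ : Set (Fin m)), ∀ T,
      g (permSlice (Equiv.swap c d) T) = g T)
    {S : {S : Finset (Fin m) // S.card = t}} (hS : g S ≠ 0) (ha : a ∈ S.1) (ha' : a' ∉ S.1) :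
    l = (((t - 1).choose (b - 1) ^ 2 : ℕ) : ℝ) - ((t - 1).choose b ^ 2 : ℕ) := by
  have hne : a ≠ a' := fun h => ha' (h ▸ ha)
  have h1 : ∀ T : {S : Finset (Fin m) // S.card = t}, a ∈ T.1 → a' ∉ T.1 → g T = g S := by
    intro T hT hT'
    apply eq_of_swap_invariant _ g hinv
    · intro x hx hxS
      simp only [Set.mem_compl_iff, Set.mem_insert_iff, Set.mem_singleton_iff, not_or]
      exact ⟨fun h => hxS (h ▸ ha), fun h => hT' (h ▸ hx)⟩
    · intro x hx hxT
      simp only [Set.mem_compl_iff, Set.mem_insert_iff, Set.mem_singleton_iff, not_or]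
      exact ⟨fun h => hxT (h ▸ hT), fun h => ha' (h ▸ hx)⟩
  have h2 : ∀ T, g T = g S * (if ({a} : Finset (Fin m)) ⊆ T.1 ∧ Disjoint {a'} T.1 then 1 else 0)
      - g S * (if ({a'} : Finset (Fin m)) ⊆ T.1 ∧ Disjoint {a} T.1 then 1 else 0) := by
    intro T
    simp only [Finset.singleton_subset_iff, Finset.disjoint_singleton_left]
    by_cases hT : a ∈ T.1 <;> by_cases hT' : a' ∈ T.1
    · have := hanti T
      rw [permSlice_swap_eq_self (by simp [hT, hT'])] at this
      simp [hT, hT']; linarith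
    · simp [hT, hT', h1 T hT hT']
    · have := h1 (permSlice (Equiv.swap a a') T) (by simpa [mem_permSlice] using hT')
        (by simpa [mem_permSlice] using hT)
      rw [hanti] at this
      simp [hT, hT']; linarith
    · have := hanti T
      rw [permSlice_swap_eq_self (by simp [hT, hT'])] at this
      simp [hT, hT']; linarith
  have h3 : ∑ T, (karloffJ m t b).adjMatrix ℝ S T
      * (g S * (if ({a} : Finset (Fin m)) ⊆ T.1 ∧ Disjoint {a'} T.1 then 1 else 0)
      - g S * (if ({a'} : Finset (Fin m)) ⊆ T.1 ∧ Disjoint {a} T.1 then 1 else 0)) = l * g S := by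
    rw [← hg S]
    exact Finset.sum_congr rfl fun T _ => by rw [h2 T]
  simp_rw [mul_sub, Finset.sum_sub_distrib, mul_left_comm _ (g S), ← Finset.mul_sum,
    sum_adjMatrix_mul_indicator, (nbrCount_singles hm hb hbt S ha ha').1,
    (nbrCount_singles hm hb hbt S ha ha').2] at h3
  apply mul_right_cancel₀ hS
  linarith

/-- At a maximiser S of |h|, the eigenvector equation bounds |l| by the number of neighbours in the
support of h. Each of these contains exactly one element of each pair, which leaves four patterns to
count. -/
theorem abs_eigenvalue_le_of_split (hm : m = 2 * t) (hb : 2 ≤ b) (hbt : b + 2 ≤ t) {l : ℝ}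
    {h : {S : Finset (Fin m) // S.card = t} → ℝ} (hh : IsEigen b l h) {a a' c c' : Fin m}
    (hsupp : ∀ T, h T ≠ 0 → ¬(a ∈ T.1 ↔ a' ∈ T.1) ∧ ¬(c ∈ T.1 ↔ c' ∈ T.1)) (hac : a ≠ c)
    (hac' : a' ≠ c') {S : {S : Finset (Fin m) // S.card = t}} (hS : h S ≠ 0)
    (hmax : ∀ T, |h T| ≤ |h S|) (ha : a ∈ S.1) (ha' : a' ∉ S.1) (hc : c ∈ S.1) (hc' : c' ∉ S.1) :
    |l| ≤ (((t - 2).choose (b - 2) ^ 2 + 2 * (t - 2).choose (b - 1) ^ 2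
      + (t - 2).choose b ^ 2 : ℕ) : ℝ) := by
  obtain ⟨e1, e2, e3, e4⟩ := nbrCount_pairs hm hb hbt S ha ha' hc hc' hac hac'
  let w : Finset (Fin m) → Finset (Fin m) → {S : Finset (Fin m) // S.card = t} → ℝ :=
    fun I O T => if I ⊆ T.1 ∧ Disjoint O T.1 then 1 else 0
  have hw0 : ∀ I O T, 0 ≤ w I O T := fun I O T => by
    simp only [w]; split_ifs <;> norm_num
  have hle : ∀ T, |h T| ≤ |h S| * (w {a, c} {a', c'} T + w {a, c'} {a', c} T
      + w {a', c} {a, c'} T + w {a', c'} {a, c} T) := by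
    intro T
    have hsum : 0 ≤ w {a, c} {a', c'} T + w {a, c'} {a', c} T
      + w {a', c} {a, c'} T + w {a', c'} {a, c} T := by
      have := hw0 {a, c} {a', c'} T
      have := hw0 {a, c'} {a', c} T
      have := hw0 {a', c} {a, c'} T
      have := hw0 {a', c'} {a, c} T
      linarith
    by_cases h0 : h T = 0
    · rw [h0, abs_zero]; exact mul_nonneg (abs_nonneg _) hsum
    · obtain ⟨s1, s2⟩ := hsupp T h0
      refine (hmax T).trans (le_mul_of_one_le_right (abs_nonneg _) ?_)
      simp only [w, Finset.insert_subset_iff, Finset.singleton_subset_iff,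
        Finset.disjoint_insert_left, Finset.disjoint_singleton_left]
      by_cases x1 : a ∈ T.1 <;> by_cases x2 : a' ∈ T.1 <;> by_cases x3 : c ∈ T.1 <;>
        by_cases x4 : c' ∈ T.1 <;> simp [x1, x2, x3, x4] at s1 s2 ⊢
  have key : |l| * |h S| ≤ |h S| * (((t - 2).choose (b - 2) ^ 2 + 2 * (t - 2).choose (b - 1) ^ 2
      + (t - 2).choose b ^ 2 : ℕ) : ℝ) := by
    rw [← abs_mul, ← hh S]
    calc |∑ T, (karloffJ m t b).adjMatrix ℝ S T * h T|
        ≤ ∑ T, (karloffJ m t b).adjMatrix ℝ S T * (|h S| * (w {a, c} {a', c'} T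
          + w {a, c'} {a', c} T + w {a', c} {a, c'} T + w {a', c'} {a, c} T)) := by
          refine (Finset.abs_sum_le_sum_abs _ _).trans (Finset.sum_le_sum fun T _ => ?_)
          rw [abs_mul, SimpleGraph.adjMatrix_apply]
          split_ifs
          · simpa using hle T
          · simp
      _ = |h S| * (((t - 2).choose (b - 2) ^ 2 + 2 * (t - 2).choose (b - 1) ^ 2
            + (t - 2).choose b ^ 2 : ℕ) : ℝ) := by
          simp_rw [mul_left_comm _ (|h S|), ← Finset.mul_sum, mul_add, Finset.sum_add_distrib]
          simp only [w, sum_adjMatrix_mul_indicator, e1, e2, e3, e4]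
          push_cast; ring
  rw [mul_comm] at key
  exact le_of_mul_le_mul_left key (abs_pos.2 hS)

/-- The eigenvalues of `J(2t, t, b)` are bounded below. -/
theorem neg_le_eigenvalue (hm : m = 2 * t) (hb : 2 ≤ b) (hbt : b + 2 ≤ t) {R : ℝ} (hR : 0 ≤ R)
    (h1 : (((t - 1).choose b ^ 2 : ℕ) : ℝ) - ((t - 1).choose (b - 1) ^ 2 : ℕ) ≤ R)
    (h2 : (((t - 2).choose (b - 2) ^ 2 + 2 * (t - 2).choose (b - 1) ^ 2
      + (t - 2).choose b ^ 2 : ℕ) : ℝ) ≤ R) {l : ℝ}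
    {f : {S : Finset (Fin m) // S.card = t} → ℝ} (hf : IsEigen b l f) (hf0 : ∃ S, f S ≠ 0) :
    -R ≤ l := by
  by_cases hinv : ∀ c d, ∀ S, f (permSlice (Equiv.swap c d) S) = f S
  · obtain ⟨S, hS⟩ := hf0
    have hconst : ∀ T, f T = f S := fun T => eq_of_swap_invariant Set.univ f
      (fun c _ d _ => hinv c d) T S (fun _ _ _ => Set.mem_univ _) (fun _ _ _ => Set.mem_univ _)
    have h3 := hf S
    simp_rw [hconst, ← Finset.sum_mul] at h3
    rw [← mul_right_cancel₀ hS h3]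
    have : 0 ≤ ∑ T, (karloffJ m t b).adjMatrix ℝ S T := Finset.sum_nonneg fun T _ => by
      rw [SimpleGraph.adjMatrix_apply]; split_ifs <;> norm_num
    linarith
  push Not at hinv
  obtain ⟨a, a', S₀, hS₀⟩ := hinv
  set g : {S : Finset (Fin m) // S.card = t} → ℝ :=
    fun S => f (permSlice (Equiv.swap a a') S) - f S with hg
  have hgE : IsEigen b l g := (hf.permSlice _).sub hf
  have hg0 : g S₀ ≠ 0 := sub_ne_zero.2 hS₀
  have hanti : ∀ T, g (permSlice (Equiv.swap a a') T) = -g T := fun T => by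
    simp only [hg, permSlice_swap_swap]; ring
  have hsplit : ∀ T, g T ≠ 0 → ¬(a ∈ T.1 ↔ a' ∈ T.1) := fun T hT h => by
    have := hanti T
    rw [permSlice_swap_eq_self h] at this
    exact hT (by linarith)
  by_cases hinv : ∀ c ∈ ({a, a'}ᶜ : Set (Fin m)), ∀ d ∈ ({a, a'}ᶜ : Set (Fin m)), ∀ T,
      g (permSlice (Equiv.swap c d) T) = g T
  · have hl : l = (((t - 1).choose (b - 1) ^ 2 : ℕ) : ℝ) - ((t - 1).choose b ^ 2 : ℕ) := by
      by_cases ha : a ∈ S₀.1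
      · have ha' : a' ∉ S₀.1 := fun h => hsplit S₀ hg0 (by simp [ha, h])
        exact eigenvalue_eq_of_antisymm hm (by omega) (by omega) hgE hanti hinv hg0 ha ha'
      · have ha' : a' ∈ S₀.1 := by
          by_contra h; exact hsplit S₀ hg0 (by simp [ha, h])
        rw [Equiv.swap_comm] at hanti
        rw [Set.pair_comm] at hinv
        exact eigenvalue_eq_of_antisymm hm (by omega) (by omega) hgE hanti hinv hg0 ha' ha
    rw [hl]; linarith
  push Not at hinv
  obtain ⟨c, hc, c', hc', S₁, hS₁⟩ := hinv
  simp only [Set.mem_compl_iff, Set.mem_insert_iff, Set.mem_singleton_iff, not_or] at hc hc'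
  set h : {S : Finset (Fin m) // S.card = t} → ℝ :=
    fun S => g (permSlice (Equiv.swap c c') S) - g S with hh
  have hhE : IsEigen b l h := (hgE.permSlice _).sub hgE
  have hh0 : h S₁ ≠ 0 := sub_ne_zero.2 hS₁
  have hsupp : ∀ T, h T ≠ 0 → ¬(a ∈ T.1 ↔ a' ∈ T.1) ∧ ¬(c ∈ T.1 ↔ c' ∈ T.1) := by
    refine fun T hT => ⟨fun e => ?_, fun e => ?_⟩
    -- Disjoint transpositions commute, so h inherits antisymmetry under the first swap and vanishes
    -- on sets fixed by it.
    · have e1 : h (permSlice (Equiv.swap a a') T) = -h T := by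
        simp only [hh]
        rw [← permSlice_swap_comm (Ne.symm hc.1) (Ne.symm hc'.1) (Ne.symm hc.2) (Ne.symm hc'.2),
          hanti, hanti]
        ring
      rw [permSlice_swap_eq_self e] at e1
      exact hT (by linarith)
    · apply hT
      simp only [hh, permSlice_swap_eq_self e, sub_self]
  obtain ⟨S, -, hmax⟩ := Finset.exists_max_image Finset.univ (fun T => |h T|) ⟨S₁, Finset.mem_univ _⟩
  replace hmax : ∀ T, |h T| ≤ |h S| := fun T => hmax T (Finset.mem_univ _)
  have hS : h S ≠ 0 := fun h0 => hh0 (by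
    have := hmax S₁
    rw [h0, abs_zero] at this
    exact abs_nonpos_iff.1 this)
  have habs : |l| ≤ R := by
    refine le_trans ?_ h2
    have hs := hsupp S hS
    -- The four surviving cases differ by exchanging the names within each pair.
    by_cases xa : a ∈ S.1 <;> by_cases xa' : a' ∈ S.1 <;> by_cases xc : c ∈ S.1 <;>
      by_cases xc' : c' ∈ S.1 <;> simp only [xa, xa', xc, xc', not_true, iff_self, and_false,
        false_and] at hs
    · exact abs_eigenvalue_le_of_split hm hb hbt hhE hsupp (Ne.symm hc.1) (Ne.symm hc'.2) hS hmax
        xa xa' xc xc'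
    · exact abs_eigenvalue_le_of_split hm hb hbt hhE (a := a) (a' := a') (c := c') (c' := c)
        (fun T hT => ⟨(hsupp T hT).1, fun e => (hsupp T hT).2 e.symm⟩)
        (Ne.symm hc'.1) (Ne.symm hc.2) hS hmax xa xa' xc' xc
    · exact abs_eigenvalue_le_of_split hm hb hbt hhE (a := a') (a' := a) (c := c) (c' := c')
        (fun T hT => ⟨fun e => (hsupp T hT).1 e.symm, (hsupp T hT).2⟩)
        (Ne.symm hc.2) (Ne.symm hc'.1) hS hmax xa' xa xc xc'
    · exact abs_eigenvalue_le_of_split hm hb hbt hhE (a := a') (a' := a) (c := c') (c' := c)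
        (fun T hT => ⟨fun e => (hsupp T hT).1 e.symm, fun e => (hsupp T hT).2 e.symm⟩)
        (Ne.symm hc'.2) (Ne.symm hc.1) hS hmax xa' xa xc' xc
  linarith [neg_abs_le l]

end Eigen

/-! ### The exact value of Max-Cut. -/

section MaxCutValue

/-- The eigenvalues of A + R are those of A shifted by R, hence nonnegative, so A + R is positive
semidefinite. -/
theorem Matrix.nonneg_dotProduct_mulVec_of_eigenvalue_bound {n : Type*} [Fintype n] [DecidableEq n]
    {A : Matrix n n ℝ} (hA : A.IsHermitian) {R : ℝ}
    (h : ∀ (l : ℝ) (f : n → ℝ), A *ᵥ f = l • f → (∃ i, f i ≠ 0) → -R ≤ l) (x : n → ℝ) :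
    -R * (x ⬝ᵥ x) ≤ x ⬝ᵥ (A *ᵥ x) := by
  have hB : (A + R • (1 : Matrix n n ℝ)).IsHermitian := by
    refine hA.add ?_
    simp [Matrix.IsHermitian]
  have hpos : (A + R • (1 : Matrix n n ℝ)).PosSemidef := by
    rw [hB.posSemidef_iff_eigenvalues_nonneg]
    intro j
    have h1 := hB.mulVec_eigenvectorBasis j
    rw [Matrix.add_mulVec, Matrix.smul_mulVec, Matrix.one_mulVec] at h1
    have h2 := h (hB.eigenvalues j - R) _ (by rw [sub_smul, ← h1, add_sub_cancel_right]) (by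
      by_contra h0
      push Not at h0
      have hn := (hB.eigenvectorBasis).orthonormal.1 j
      have : hB.eigenvectorBasis j = 0 := by ext i; exact h0 i
      rw [this, norm_zero] at hn
      exact zero_ne_one hn)
    simp only [Pi.zero_apply]
    linarith
  have := hpos.dotProduct_mulVec_nonneg x
  rw [Matrix.add_mulVec, Matrix.smul_mulVec, Matrix.one_mulVec, dotProduct_add, dotProduct_smul,
    star_trivial, smul_eq_mul] at this
  linarith

variable {m t b : ℕ}

theorem le_choose_of_pos_of_lt {n k : ℕ} (hk : 0 < k) (hkn : k < n) : n ≤ n.choose k := by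
  induction n generalizing k with
  | zero => omega
  | succ n ih =>
    obtain ⟨k, rfl⟩ := Nat.exists_eq_succ_of_ne_zero hk.ne'
    rw [Nat.succ_eq_add_one, Nat.choose_succ_succ']
    rcases Nat.eq_zero_or_pos k with rfl | h0
    · simp
    · have := ih h0 (by omega)
      have := Nat.choose_pos (n := n) (k := k + 1) (by omega)
      omega

/-- Apply the quadratic form bound to the spin vector, whose squared norm is the number of vertices.
-/
theorem maxCut_karloffJ_le (hm : m = 2 * t) (hb : 2 ≤ b) (hbt : b + 2 ≤ t) {R : ℝ} (hR : 0 ≤ R)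
    (h1 : (((t - 1).choose b ^ 2 : ℕ) : ℝ) - ((t - 1).choose (b - 1) ^ 2 : ℕ) ≤ R)
    (h2 : (((t - 2).choose (b - 2) ^ 2 + 2 * (t - 2).choose (b - 1) ^ 2
      + (t - 2).choose b ^ 2 : ℕ) : ℝ) ≤ R) :
    maxCut (karloffJ m t b) ≤ Fintype.card {S : Finset (Fin m) // S.card = t} / 4
      * ((t.choose b ^ 2 : ℕ) + R) := by
  refine Finset.sup'_le _ _ fun z _ => ?_
  have hq := Matrix.nonneg_dotProduct_mulVec_of_eigenvalue_bound
    (A := (karloffJ m t b).adjMatrix ℝ) (R := R)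
    (by rw [Matrix.IsHermitian, Matrix.conjTranspose_eq_transpose_of_trivial]
        exact (karloffJ m t b).isSymm_adjMatrix)
    (fun l f hf hf0 => neg_le_eigenvalue hm hb hbt hR h1 h2 (fun S => congrFun hf S) hf0)
    (fun S => spin (z S))
  have hxx : (fun S => spin (z S)) ⬝ᵥ (fun S => spin (z S))
      = (Fintype.card {S : Finset (Fin m) // S.card = t} : ℝ) := by
    simp [dotProduct, spin_mul_self]
  have hxAx : (fun S => spin (z S)) ⬝ᵥ ((karloffJ m t b).adjMatrix ℝ *ᵥ fun S => spin (z S))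
      = ∑ S, ∑ T, (karloffJ m t b).adjMatrix ℝ S T * (spin (z S) * spin (z T)) := by
    simp only [dotProduct, Matrix.mulVec, Finset.mul_sum]
    exact Finset.sum_congr rfl fun S _ => Finset.sum_congr rfl fun T _ => by ring
  rw [hxx, hxAx] at hq
  rw [cutValue_eq_sum]
  simp_rw [mul_sub, mul_one, Finset.sum_sub_distrib]
  rw [sum_adjMatrix_of_isRegular _ (karloffJ_isRegular hm (by omega : b < t))]
  linarith

theorem le_maxCut_karloffJ (hm : m = 2 * t) (hbt : b < t) :
    Fintype.card {S : Finset (Fin m) // S.card = t} / 2 * (t.choose b * (t - 1).choose b : ℕ)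
      ≤ maxCut (karloffJ m t b) := by
  let a : Fin m := ⟨0, by omega⟩
  -- The cut by membership of one fixed element; every vertex has the same number of neighbours
  -- across it.
  let z : {S : Finset (Fin m) // S.card = t} → Bool := fun S => decide (a ∈ S.1)
  refine le_trans (le_of_eq ?_) (Finset.le_sup' (cutValue (karloffJ m t b)) (Finset.mem_univ z))
  rw [cutValue_eq_sum]
  have key : ∀ S, ∑ T, (karloffJ m t b).adjMatrix ℝ S T * (1 - spin (z S) * spin (z T))
      = 2 * (t.choose b * (t - 1).choose b : ℕ) := by
    intro S
    have hS := S.2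
    have hSc := card_compl_slice hm S
    by_cases ha : a ∈ S.1
    · have h1 : ∀ T, 1 - spin (z S) * spin (z T)
          = 2 * (if ∅ ⊆ T.1 ∧ Disjoint {a} T.1 then 1 else 0) := by
        intro T
        by_cases hT : a ∈ T.1 <;> simp [z, spin, ha, hT]; norm_num
      have e1 : (S.1 \ {a}).card = t - 1 := by
        rw [Finset.card_sdiff_of_subset (by simpa using ha), hS, Finset.card_singleton]
      have e2 : (S.1ᶜ \ {a}).card = t := by
        rw [Finset.sdiff_singleton_eq_erase, Finset.erase_eq_of_notMem (by simpa using ha), hSc]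
      simp_rw [h1, mul_left_comm _ (2 : ℝ), ← Finset.mul_sum, sum_adjMatrix_mul_indicator]
      rw [nbrCount_eq hbt S _ _ (by simp) (by simp) (by simp), Finset.empty_union, e1, e2]
      simp [Nat.choose_symm hbt.le, mul_comm]
    · have h1 : ∀ T, 1 - spin (z S) * spin (z T)
          = 2 * (if {a} ⊆ T.1 ∧ Disjoint ∅ T.1 then 1 else 0) := by
        intro T
        by_cases hT : a ∈ T.1 <;> simp [z, spin, ha, hT]; norm_num
      have e1 : (S.1 \ {a}).card = t := by
        rw [Finset.sdiff_singleton_eq_erase, Finset.erase_eq_of_notMem ha, hS]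
      have e2 : (S.1ᶜ \ {a}).card = t - 1 := by
        rw [Finset.card_sdiff_of_subset (by simpa using ha), hSc, Finset.card_singleton]
      have e3 : S.1 ∩ {a} = ∅ := Finset.inter_singleton_of_notMem ha
      have e4 : S.1ᶜ ∩ {a} = {a} := Finset.inter_singleton_of_mem (by simpa using ha)
      simp_rw [h1, mul_left_comm _ (2 : ℝ), ← Finset.mul_sum, sum_adjMatrix_mul_indicator]
      rw [nbrCount_eq hbt S _ _ (by simp) (by simp [e3]) (by rw [e4]; simp; omega),
        Finset.union_empty, e1, e2, e3, e4, Finset.card_empty, Finset.card_singleton,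
        Nat.choose_symm_of_eq_add (n := t - 1) (a := t - b - 1) (b := b) (by omega), Nat.sub_zero]
  rw [Finset.sum_congr rfl fun S _ => key S]
  simp
  ring

theorem maxCut_karloffJ (hm : m = 2 * t) (hb : 2 ≤ b) (hbt : b + 2 ≤ t)
    (hp1 : 0.154 * (t : ℝ) ≤ b) (hp2 : (b : ℝ) ≤ 0.158 * t) :
    maxCut (karloffJ m t b) = Fintype.card {S : Finset (Fin m) // S.card = t}
      * (t.choose b ^ 2 : ℕ) / 2 * (1 - b / t) := by
  -- Writing t = s + 2 and b = k + 2 avoids truncated subtraction in the binomials.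
  obtain ⟨s, rfl⟩ := Nat.exists_eq_add_of_le' (by omega : 2 ≤ t)
  obtain ⟨k, rfl⟩ := Nat.exists_eq_add_of_le' hb
  have hks : k + 2 ≤ s := by omega
  set p : ℝ := ((k + 2 : ℕ) : ℝ) / ((s + 2 : ℕ) : ℝ) with hp
  have hT : (0 : ℝ) < ((s + 2 : ℕ) : ℝ) := by positivity
  have hB : ((k + 2 : ℕ) : ℝ) = p * ((s + 2 : ℕ) : ℝ) := by rw [hp]; field_simp
  have hpl : 0.154 ≤ p := by rw [hp, le_div_iff₀ hT]; exact hp1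
  have hpu : p ≤ 0.158 := by rw [hp, div_le_iff₀ hT]; exact hp2
  set D : ℝ := ((s + 2).choose (k + 2) : ℝ) with hD
  have hD0 : 0 ≤ D := Nat.cast_nonneg _
  have hx1 : ((s + 1).choose (k + 1) : ℝ) = D * p := by
    have : ((s + 2 : ℕ) : ℝ) * ((s + 1).choose (k + 1) : ℝ) = D * ((k + 2 : ℕ) : ℝ) := by
      rw [hD]
      exact_mod_cast Nat.add_one_mul_choose_eq (s + 1) (k + 1)
    rw [hB] at this
    apply mul_left_cancel₀ hT.ne'
    linarith
  have hx2 : ((s + 1).choose (k + 2) : ℝ) = D * (1 - p) := by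
    have h : ((s + 1).choose (k + 2) : ℝ) * ((s + 2 : ℕ) : ℝ) = D * ((s - k : ℕ) : ℝ) := by
      have := Nat.choose_mul_succ_eq (s + 1) (k + 2)
      rw [show s + 1 + 1 - (k + 2) = s - k by omega] at this
      rw [hD]
      exact_mod_cast this
    rw [show ((s - k : ℕ) : ℝ) = ((s + 2 : ℕ) : ℝ) - ((k + 2 : ℕ) : ℝ) by
      rw [Nat.cast_sub (by omega)]; push_cast; ring, hB] at h
    apply mul_left_cancel₀ hT.ne'
    linarith
  have hs1 : (0 : ℝ) < (s : ℝ) + 1 := by positivity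
  have hks' : (k : ℝ) + 2 ≤ s := by exact_mod_cast hks
  have hB' : (k : ℝ) + 2 = p * ((s : ℝ) + 2) := by have := hB; push_cast at this; exact this
  have hy0 : (s.choose k : ℝ) ≤ D * (p * p) := by
    have h : ((s : ℝ) + 1) * (s.choose k : ℝ) = (s + 1).choose (k + 1) * ((k : ℝ) + 1) := by
      exact_mod_cast Nat.add_one_mul_choose_eq s k
    rw [hx1] at h
    apply le_of_mul_le_mul_left _ hs1
    have : (k : ℝ) + 1 ≤ p * (s + 1) := by nlinarith
    rw [h]
    calc D * p * ((k : ℝ) + 1) ≤ D * p * (p * (s + 1)) :=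
          mul_le_mul_of_nonneg_left this (mul_nonneg hD0 (by linarith))
      _ = _ := by ring
  have hy2 : (s.choose (k + 2) : ℝ) ≤ D * ((1 - p) * (1 - p)) := by
    have h : (s.choose (k + 2) : ℝ) * ((s : ℝ) + 1)
        = (s + 1).choose (k + 2) * ((s : ℝ) - k - 1) := by
      have := Nat.choose_mul_succ_eq s (k + 2)
      rw [← Nat.cast_inj (R := ℝ), Nat.cast_mul, Nat.cast_mul,
        Nat.cast_sub (by omega : k + 2 ≤ s + 1)] at this
      push_cast at this
      linarith
    rw [hx2] at h
    apply le_of_mul_le_mul_right _ hs1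
    have : (s : ℝ) - k - 1 ≤ (1 - p) * (s + 1) := by nlinarith
    rw [h]
    calc D * (1 - p) * ((s : ℝ) - k - 1) ≤ D * (1 - p) * ((1 - p) * (s + 1)) :=
          mul_le_mul_of_nonneg_left this (mul_nonneg hD0 (by linarith))
      _ = _ := by ring
  have hy1 : (s.choose (k + 1) : ℝ) ≤ D * ((1 - p) * (2 * p)) := by
    have h : ((s : ℝ) + 1) * (s.choose (k + 1) : ℝ) = (s + 1).choose (k + 2) * ((k : ℝ) + 2) := by
      exact_mod_cast Nat.add_one_mul_choose_eq s (k + 1)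
    rw [hx2] at h
    apply le_of_mul_le_mul_left _ hs1
    -- The exact ratio is p(s + 2)/(s + 1); the crude factor 2 is affordable in `hnum`.
    have : (k : ℝ) + 2 ≤ 2 * p * (s + 1) := by nlinarith
    rw [h]
    calc D * (1 - p) * ((k : ℝ) + 2) ≤ D * (1 - p) * (2 * p * (s + 1)) :=
          mul_le_mul_of_nonneg_left this (mul_nonneg hD0 (by linarith))
      _ = _ := by ring
  have hnum : (p * p) ^ 2 + 2 * ((1 - p) * (2 * p)) ^ 2 + ((1 - p) * (1 - p)) ^ 2 ≤ 1 - 2 * p := by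
    have a1 : p * p ≤ 0.158 * 0.158 := by nlinarith
    have a2 : (1 - p) * (1 - p) ≤ 0.846 * 0.846 := by nlinarith
    have a3 : (1 - p) * (2 * p) ≤ 0.846 * (2 * 0.158) := by nlinarith
    have b1 := pow_le_pow_left₀ (mul_self_nonneg p) a1 2
    have b2 := pow_le_pow_left₀ (mul_self_nonneg (1 - p)) a2 2
    have b3 := pow_le_pow_left₀ (by nlinarith : 0 ≤ (1 - p) * (2 * p)) a3 2
    norm_num at b1 b2 b3 ⊢
    linarith
  -- This R makes the first condition an equality and leaves slack in the second; it is also the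
  -- value at which the spectral bound meets the cut by one element.
  have hup := maxCut_karloffJ_le (R := D ^ 2 * (1 - 2 * p)) hm hb hbt
    (mul_nonneg (sq_nonneg _) (by linarith))
    (by
      simp only [show s + 2 - 1 = s + 1 by omega, show k + 2 - 1 = k + 1 by omega]
      push_cast
      rw [hx1, hx2]
      apply le_of_eq; ring)
    (by
      simp only [show s + 2 - 2 = s by omega, show k + 2 - 1 = k + 1 by omega,
        show k + 2 - 2 = k by omega]
      push_cast
      have c0 := pow_le_pow_left₀ (Nat.cast_nonneg _) hy0 2
      have c1 := pow_le_pow_left₀ (Nat.cast_nonneg _) hy1 2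
      have c2 := pow_le_pow_left₀ (Nat.cast_nonneg _) hy2 2
      have c3 := mul_le_mul_of_nonneg_left hnum (sq_nonneg D)
      calc _ ≤ (D * (p * p)) ^ 2 + 2 * (D * ((1 - p) * (2 * p))) ^ 2
            + (D * ((1 - p) * (1 - p))) ^ 2 := by linarith
        _ = D ^ 2 * ((p * p) ^ 2 + 2 * ((1 - p) * (2 * p)) ^ 2 + ((1 - p) * (1 - p)) ^ 2) := by ring
        _ ≤ _ := c3)
  have hlow := le_maxCut_karloffJ hm (by omega : k + 2 < s + 2)
  rw [show s + 2 - 1 = s + 1 by omega] at hlow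
  rw [Nat.cast_mul, hx2, ← hD] at hlow
  rw [Nat.cast_pow, ← hD] at hup ⊢
  refine le_antisymm (hup.trans (le_of_eq (by ring))) (le_trans (le_of_eq (by ring)) hlow)

end MaxCutValue

/-! ### The limit of the ratio. -/

section Limit

/-- The fraction of elements of a vertex shared with a neighbour tends to `(cos θ + 1) / 2`. -/
theorem tendsto_karloffB_div {θ : ℝ} :
    Filter.Tendsto (fun m : ℕ => 2 * ((karloffB θ m : ℝ) / m)) Filter.atTop
      (nhds ((Real.cos θ + 1) / 2)) := by
  have h := ((tendsto_nat_ceil_mul_div_atTop (R := ℝ) (a := 1 / 4 * (Real.cos θ + 1))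
    (by linarith [Real.neg_one_le_cos θ])).comp tendsto_natCast_atTop_atTop).const_mul 2
  rw [show (2 : ℝ) * (1 / 4 * (Real.cos θ + 1)) = (Real.cos θ + 1) / 2 by ring] at h
  exact h

theorem tendsto_one_div_sqrt_sub_one :
    Filter.Tendsto (fun m : ℕ => 1 / Real.sqrt (m - 1 : ℕ)) Filter.atTop (nhds 0) := by
  have h := Real.tendsto_sqrt_atTop.comp
    ((tendsto_natCast_atTop_atTop (R := ℝ)).comp (Filter.tendsto_sub_atTop_nat 1))
  refine h.inv_tendsto_atTop.congr fun m => ?_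
  simp

theorem qaoaValue_div_maxCut_bounds {m t b : ℕ} (hm : m = 2 * t) (hb : 2 ≤ b) (hbt : b + 2 ≤ t)
    (hp1 : 0.154 * (t : ℝ) ≤ b) (hp2 : (b : ℝ) ≤ 0.158 * t) :
    1 / (2 * (1 - 2 * ((b : ℝ) / m))) ≤ qaoaValue (karloffJ m t b) 1 / maxCut (karloffJ m t b) ∧
    qaoaValue (karloffJ m t b) 1 / maxCut (karloffJ m t b)
      ≤ 1 / (2 * (1 - 2 * ((b : ℝ) / m))) * (1 + 1 / Real.sqrt (m - 1 : ℕ)) := by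
  have ht : (0 : ℝ) < t := by exact_mod_cast (by omega : 0 < t)
  have hpe : 2 * ((b : ℝ) / m) = b / t := by
    rw [hm]; push_cast; field_simp
  have hp : (b : ℝ) / t ≤ 0.158 := by rwa [div_le_iff₀ ht]
  have hreg := karloffJ_isRegular (m := m) hm (by omega : b < t)
  have hchoose := le_choose_of_pos_of_lt (by omega : 0 < b) (by omega : b < t)
  -- A degree of at least m makes the QAOA error term at most 1/√(m - 1).
  have hd : m ≤ t.choose b ^ 2 := by nlinarith
  have hN : (0 : ℝ) < Fintype.card {S : Finset (Fin m) // S.card = t} := by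
    rw [Nat.cast_pos, Fintype.card_pos_iff]
    obtain ⟨S, -, hS⟩ := Finset.exists_subset_card_eq
      (s := (Finset.univ : Finset (Fin m))) (n := t) (by simp; omega)
    exact ⟨⟨S, hS⟩⟩
  have hd0 : (0 : ℝ) < (t.choose b ^ 2 : ℕ) := by exact_mod_cast (by omega : 0 < t.choose b ^ 2)
  have hlow := le_qaoaValue_one _ hreg
  have hup := qaoaValue_one_le _ hreg (by omega)
  rw [maxCut_karloffJ hm hb hbt hp1 hp2, hpe]
  set N : ℝ := ((Fintype.card {S : Finset (Fin m) // S.card = t} : ℕ) : ℝ)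
  set d : ℝ := ((t.choose b ^ 2 : ℕ) : ℝ)
  set p : ℝ := (b : ℝ) / t
  have h1p : 0 < 1 - p := by linarith
  have hND : 0 < N * d := mul_pos hN hd0
  have hden : 0 < N * d / 2 * (1 - p) := by positivity
  have hε : 1 / Real.sqrt (t.choose b ^ 2 - 1 : ℕ) ≤ 1 / Real.sqrt (m - 1 : ℕ) := by
    apply one_div_le_one_div_of_le
    · exact Real.sqrt_pos.2 (by exact_mod_cast (by omega : 0 < m - 1))
    · exact Real.sqrt_le_sqrt (by exact_mod_cast Nat.sub_le_sub_right hd 1)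
  constructor
  · rw [le_div_iff₀ hden]
    refine le_trans (le_of_eq ?_) hlow
    field_simp; ring
  · rw [div_le_iff₀ hden]
    refine (hup.trans (mul_le_mul_of_nonneg_left (add_le_add_right hε 1) (by positivity))).trans
      (le_of_eq ?_)
    field_simp; ring

theorem tendsto_qaoaValue_div_maxCut {θ : ℝ} (hθ : IsGWAngle θ) :
    Filter.Tendsto (fun m : ℕ => qaoaValue (karloffG θ m) 1 / maxCut (karloffG θ m))
      (Filter.atTop ⊓ Filter.principal {m : ℕ | Even m}) (nhds (1 / (1 - Real.cos θ))) := by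
  obtain ⟨hc1, hc2, -⟩ := hθ.cos_bounds
  have hB := tendsto_karloffB_div (θ := θ)
  have hlow : Filter.Tendsto (fun m : ℕ => 1 / (2 * (1 - 2 * ((karloffB θ m : ℝ) / m))))
      Filter.atTop (nhds (1 / (1 - Real.cos θ))) := by
    have h := ((hB.const_sub 1).const_mul 2).inv₀ (by linarith)
    rw [show 2 * (1 - (Real.cos θ + 1) / 2) = 1 - Real.cos θ by ring] at h
    simpa only [one_div] using h
  have hup : Filter.Tendsto (fun m : ℕ => 1 / (2 * (1 - 2 * ((karloffB θ m : ℝ) / m)))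
      * (1 + 1 / Real.sqrt (m - 1 : ℕ))) Filter.atTop (nhds (1 / (1 - Real.cos θ))) := by
    simpa using hlow.mul (tendsto_one_div_sqrt_sub_one.const_add 1)
  have hev : ∀ᶠ m : ℕ in Filter.atTop ⊓ Filter.principal {m : ℕ | Even m},
      1 / (2 * (1 - 2 * ((karloffB θ m : ℝ) / m)))
        ≤ qaoaValue (karloffG θ m) 1 / maxCut (karloffG θ m) ∧
      qaoaValue (karloffG θ m) 1 / maxCut (karloffG θ m)
        ≤ 1 / (2 * (1 - 2 * ((karloffB θ m : ℝ) / m))) * (1 + 1 / Real.sqrt (m - 1 : ℕ)) := by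
    rw [Filter.eventually_inf_principal]
    -- The limit of p lies strictly inside (0.154, 0.158). With m ≥ 100, hence t ≥ 50, these bounds
    -- also give b ≥ 2 and b + 2 ≤ t.
    filter_upwards [hB.eventually_const_lt (by linarith : 0.154 < (Real.cos θ + 1) / 2),
      hB.eventually_lt_const (by linarith : (Real.cos θ + 1) / 2 < 0.158),
      Filter.eventually_ge_atTop 100] with m h1 h2 hm100 hm
    obtain ⟨t, rfl⟩ := hm
    have ht2 : (t + t) / 2 = t := by omega
    have ht : (50 : ℝ) ≤ t := by exact_mod_cast (by omega : 50 ≤ t)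
    have hpe : 2 * ((karloffB θ (t + t) : ℝ) / (t + t : ℕ)) = karloffB θ (t + t) / t := by
      push_cast; field_simp; ring
    rw [hpe, lt_div_iff₀ (by linarith)] at h1
    rw [hpe, div_lt_iff₀ (by linarith)] at h2
    unfold karloffG
    refine qaoaValue_div_maxCut_bounds (by omega) ?_ ?_ (by rw [ht2]; exact h1.le)
      (by rw [ht2]; exact h2.le)
    · have : (1 : ℝ) < karloffB θ (t + t) := by linarith
      exact_mod_cast this
    · rw [ht2]
      have : ((karloffB θ (t + t) + 2 : ℕ) : ℝ) ≤ t := by push_cast; linarith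
      exact_mod_cast this
  exact tendsto_of_tendsto_of_tendsto_of_le_of_le' (hlow.mono_left inf_le_left)
    (hup.mono_left inf_le_left) (hev.mono fun _ h => h.1) (hev.mono fun _ h => h.2)

end Limit

theorem mainTheorem2 :
    (∃! θ : ℝ, IsGWAngle θ) ∧
    ∀ θ : ℝ, IsGWAngle θ →
      (∀ m : ℕ, Even m → 12 ≤ m →
        IsGreatest (Set.range fun q : (Fin 1 → ℝ) × (Fin 1 → ℝ) =>
          qaoaExpectation (karloffG θ m) 1 q.1 q.2) (qaoaValue (karloffG θ m) 1)) ∧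
      Filter.Tendsto (fun m : ℕ => qaoaValue (karloffG θ m) 1 / maxCut (karloffG θ m))
        (Filter.atTop ⊓ Filter.principal {m : ℕ | Even m})
        (nhds (1 / (1 - Real.cos θ))) ∧
      |1 / (1 - Real.cos θ) - 0.592| < 0.0005 :=
  ⟨existsUnique_isGWAngle, fun _ hθ => ⟨fun _ _ _ => qaoaValue_one_isGreatest _,
    tendsto_qaoaValue_div_maxCut hθ, hθ.cos_bounds.2.2⟩⟩
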